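/- Let $k>0$ and $l\ge 0$ be integers, and let $a_0,a_1,\dots,a_k$ and $b_0,b_1,\dots,b_l$ be fixed integers with $b_l=1$ and $b_j=b_{l-j}$ for $0\le j\le l$. For $n>k$ consider the reciprocal integer polynomial $$P_{2n+2l}(x)=x^{n+l}\left(\sum_{j=0}^l b_j\left(x^{n+j}+\frac1{x^{n+j}}\right)+a_0+\sum_{j=1}^k a_j\left(x^j+\frac1{x^j}\right)\right),$$ which is monic because $b_l=1$. For an integer polynomial $P$ of positive degree let $U(P)$ be the number of its complex zeros of modulus $1$, and let $C(P)$ be the number of its complex zeros of modulus different from $1$ divided by $\deg P$, zeros being counted with multiplicity. Put $$f_2(t)=-\frac{a_0}2-\sum_{j=1}^k a_j\cos jt,\qquad E(t)=\begin{cases}\displaystyle b_{l/2}+\sum_{j=0}^{l/2-1}2b_j\cos\big((l/2-j)t\big), & l \text{ even},\\[2mm] \displaystyle\sum_{j=0}^{(l-1)/2}2b_j\cos\big((l/2-j)t\big), & l\text{ odd}.\end{cases}$$ Then for every $n>k$ one has $\deg P_{2n+2l}=2n+2l$ and $C(P_{2n+2l})=1-\dfrac{U(P_{2n+2l})}{2n+2l}$.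 Moreover, the set $\{t\in[0,2\pi]: |f_2(t)|\le|E(t)|\}$ is the union of finitely many (possibly zero) pairwise disjoint closed intervals $[\alpha_1,\beta_1],\dots,[\alpha_r,\beta_r]$, where $\alpha_j\le\beta_j$ for all $j$ and $\beta_i<\alpha_j$ for $i<j$ (an interval may be a single point), and the limit of $C(P_{2n+2l})$ as $n\to\infty$ exists and equals $$\lim_{n\to\infty}C(P_{2n+2l})=1-\sum_{j=1}^r\frac{\beta_j-\alpha_j}{2\pi}.$$ -/

import Mathlib

open Filter Topology Polynomial

noncomputable section

namespace LimitRatio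

/-- Number of complex zeros of `p` inside the open unit disc, with multiplicity. -/
def numInside (p : ℤ[X]) : ℕ := (p.aroots ℂ).countP (fun z => ‖z‖ < 1)

/-- Number of unimodular complex zeros of `p`, with multiplicity. -/
def numUnimodular (p : ℤ[X]) : ℕ := (p.aroots ℂ).countP (fun z => ‖z‖ = 1)

/-- Number of complex zeros of `p` outside the closed unit disc, with multiplicity. -/
def numOutside (p : ℤ[X]) : ℕ := (p.aroots ℂ).countP (fun z => 1 < ‖z‖)

/-- The ratio `C(p)` between the number of nonunimodular zeros of `p` and its degree. -/
def ratio (p : ℤ[X]) : ℝ := ((numInside p : ℝ) + (numOutside p : ℝ)) / (p.natDegree : ℝ)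

/-- The polynomial
`x^(n+l) * (∑_{j=0}^l b_j (x^(n+j) + x^(-(n+j))) + a_0 + ∑_{j=1}^k a_j (x^j + x^(-j)))`,
with the factor `x^(n+l)` multiplied in. The natural-number subtractions are exact whenever
`k ≤ n + l`; only large `n` matter. -/
def poly (k l : ℕ) (a b : ℕ → ℤ) (n : ℕ) : ℤ[X] :=
  (∑ j ∈ Finset.Icc 0 l, C (b j) * (X ^ ((n + l) + (n + j)) + X ^ ((n + l) - (n + j))))
    + C (a 0) * X ^ (n + l)
    + ∑ j ∈ Finset.Icc 1 k, C (a j) * (X ^ ((n + l) + j) + X ^ ((n + l) - j))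

/-- The envelope `E(t)`:
`∑_{j=0}^{l/2-1} 2 b_j cos((l/2-j)t) + b_{l/2}` for even `l`, and
`∑_{j=0}^{(l-1)/2} 2 b_j cos((l/2-j)t)` for odd `l`. -/
def envelope (l : ℕ) (b : ℕ → ℤ) (t : ℝ) : ℝ :=
  if Even l then
    (∑ j ∈ Finset.range (l / 2), 2 * (b j : ℝ) * Real.cos (((l : ℝ) / 2 - (j : ℝ)) * t))
      + (b (l / 2) : ℝ)
  else
    ∑ j ∈ Finset.range ((l + 1) / 2), 2 * (b j : ℝ) * Real.cos (((l : ℝ) / 2 - (j : ℝ)) * t)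

/-- The function `f₂(t) = -a_0/2 - ∑_{j=1}^k a_j cos(jt)`. -/
def f₂ (k : ℕ) (a : ℕ → ℤ) (t : ℝ) : ℝ :=
  -(a 0 : ℝ) / 2 - ∑ j ∈ Finset.Icc 1 k, (a j : ℝ) * Real.cos ((j : ℝ) * t)

end LimitRatio

end

/-!
On the unit circle, `x = exp (i t)`, the polynomial equals, up to a factor of modulus `1`,
`2 (E(t) cos ((n + l / 2) t) - f₂(t))` (`LimitRatio.eval_map_poly_exp`). So its unimodular zeros have
arguments in the set `S = {|f₂| ≤ |E|}`, and the claim is that their number is asymptotic to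
`(2 n + 2 l) |S| / 2π`. Upper and lower bounds are proved separately.

*Upper bound, with multiplicity.* The arguments of all the zeros are equidistributed
(`Polynomial.tendsto_argDiscrepancy`), hence asymptotically at most the proportion `|S| / 2π` of
them lies in the closed set `S` (`Polynomial.eventually_countP_norm_eq_one_le`). Equidistribution
holds for any monic polynomials of growing degree whose coefficients are bounded in `ℓ¹` and whose
constant coefficient has modulus `1`. Indeed the power sums of the zeros are bounded by Newton's
identities, and by Landau's bound on the Mahler measure `∑ |log ‖z‖|` over the zeros is bounded, so
that replacing each zero `z` by `z / ‖z‖` changes a power sum by a bounded amount. Thus the Weyl sums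
of the arguments are bounded, which is `o` of the degree.

*Lower bound.* If `|f₂| < |E|` on an interval between consecutive extrema of `cos ((n + l / 2) t)`,
the intermediate value theorem gives a zero in its interior
(`LimitRatio.exists_root_of_abs_f₂_lt`), and these intervals fill up the open set `{|f₂| < |E|}` as
`n` grows (`eventually_volume_le_card_mul`). Now `4 (E² - f₂²)` is, up to a factor of modulus `1`, a
polynomial in `exp (i t)`. If this polynomial is not zero, then `|f₂| = |E|` at finitely many points
only, and the lower bound is `|S|` again. If it is zero, then `l` is even and the polynomial
factors as `(∑ b_j x ^ j) (x ^ (n + l / 2) ± 1) ^ 2`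
(`LimitRatio.exists_map_poly_eq_of_gapPoly_eq_zero`), so that all but at most `l` zeros are
unimodular.

The decomposition of `S` into finitely many intervals holds because the left endpoint of a component
of `S` is `0` or a point where `|f₂| = |E|`, unless `S` is everything
(`LimitRatio.finite_left_endpoints_dominatedSet`).
-/

open MeasureTheory

/-! ### Polynomials with bounded coefficients -/

/-- The sum of the norms of the coefficients of a complex polynomial. -/
noncomputable def Polynomial.coeffNorm (p : ℂ[X]) : ℝ := p.sum fun _ a => ‖a‖

theorem Polynomial.coeffNorm_eq_sum_range {p : ℂ[X]} {N : ℕ} (h : p.natDegree < N) :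
    p.coeffNorm = ∑ i ∈ Finset.range N, ‖p.coeff i‖ :=
  Polynomial.sum_over_range' p (by simp) N h

theorem Polynomial.coeffNorm_add_le (p q : ℂ[X]) :
    (p + q).coeffNorm ≤ p.coeffNorm + q.coeffNorm := by
  have hN := Polynomial.natDegree_add_le p q
  rw [coeffNorm_eq_sum_range (N := max p.natDegree q.natDegree + 1) (by omega),
    coeffNorm_eq_sum_range (p := p) (N := max p.natDegree q.natDegree + 1) (by omega),
    coeffNorm_eq_sum_range (p := q) (N := max p.natDegree q.natDegree + 1) (by omega),
    ← Finset.sum_add_distrib]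
  exact Finset.sum_le_sum fun i _ => by rw [coeff_add]; exact norm_add_le _ _

theorem Polynomial.coeffNorm_sum_le {ι : Type*} (s : Finset ι) (f : ι → ℂ[X]) :
    (∑ i ∈ s, f i).coeffNorm ≤ ∑ i ∈ s, (f i).coeffNorm := by
  classical
  induction s using Finset.induction_on with
  | empty => simp [coeffNorm]
  | insert a s ha ih =>
    rw [Finset.sum_insert ha, Finset.sum_insert ha]
    exact (coeffNorm_add_le _ _).trans (by gcongr)

theorem Polynomial.coeffNorm_X_pow_mul_le (m : ℕ) (p : ℂ[X]) :
    (X ^ m * p).coeffNorm ≤ p.coeffNorm := by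
  conv_lhs => rw [p.as_sum_support, Finset.mul_sum]
  refine (coeffNorm_sum_le _ _).trans (Finset.sum_le_sum fun i _ => le_of_eq ?_)
  rw [X_pow_mul_monomial, coeffNorm, sum_monomial_index _ _ (by simp)]

theorem Polynomial.norm_coeff_le_coeffNorm (p : ℂ[X]) (i : ℕ) : ‖p.coeff i‖ ≤ p.coeffNorm := by
  rw [coeffNorm_eq_sum_range (N := max p.natDegree i + 1) (by omega)]
  exact Finset.single_le_sum (f := fun j => ‖p.coeff j‖) (fun _ _ => norm_nonneg _)
    (Finset.mem_range.2 (by omega))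

theorem Multiset.exists_eq_map_fin {α : Type*} (s : Multiset α) :
    ∃ f : Fin (Multiset.card s) → α, s = Finset.univ.val.map f := by
  induction s using Quotient.inductionOn with
  | h L =>
    refine ⟨fun i => L.get i, ?_⟩
    have : (List.finRange L.length).map L.get = L := by simp
    conv_lhs => rw [← this]
    rfl

/-- Newton's identities for the power sums of a multiset. -/
theorem Multiset.sum_map_pow_eq {R : Type*} [CommRing R] (s : Multiset R) {k : ℕ} (hk : 0 < k) :
    (s.map (· ^ k)).sum = (-1) ^ (k + 1) * k * s.esymm k -
      ∑ a ∈ Finset.HasAntidiagonal.antidiagonal k with a.1 ∈ Set.Ioo 0 k,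
        (-1) ^ a.1 * s.esymm a.1 * (s.map (· ^ a.2)).sum := by
  obtain ⟨f, hf⟩ := s.exists_eq_map_fin
  have hp : ∀ j, MvPolynomial.aeval f (MvPolynomial.psum (Fin (Multiset.card s)) R j) =
      (s.map (· ^ j)).sum := by
    intro j
    conv_rhs => rw [hf]
    rw [Multiset.map_map]
    simp only [MvPolynomial.psum, map_sum, map_pow, MvPolynomial.aeval_X]
    rfl
  have he : ∀ j, MvPolynomial.aeval f (MvPolynomial.esymm (Fin (Multiset.card s)) R j) =
      s.esymm j := by
    intro j
    rw [MvPolynomial.aeval_esymm_eq_multiset_esymm, ← hf]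
  have h := congrArg (MvPolynomial.aeval f)
    (MvPolynomial.psum_eq_mul_esymm_sub_sum (Fin (Multiset.card s)) R k hk)
  simpa only [hp, map_sub, map_mul, map_pow, map_neg, map_one, map_natCast, he, map_sum] using h

theorem Polynomial.Monic.norm_esymm_roots_le {p : ℂ[X]} (hp : p.Monic) (i : ℕ) :
    ‖p.roots.esymm i‖ ≤ p.coeffNorm := by
  have hs : Multiset.card p.roots = p.natDegree := (IsAlgClosed.splits p).natDegree_eq_card_roots.symm
  by_cases hi : i ≤ p.natDegree
  · have h := p.coeff_eq_esymm_roots_of_card hs (k := p.natDegree - i) (by omega)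
    rw [hp.leadingCoeff, one_mul, show p.natDegree - (p.natDegree - i) = i by omega] at h
    calc ‖p.roots.esymm i‖ = ‖p.coeff (p.natDegree - i)‖ := by simp [h]
      _ ≤ _ := p.norm_coeff_le_coeffNorm _
  · rw [Multiset.esymm, Multiset.powersetCard_eq_empty i (by omega)]
    simpa using (norm_nonneg _).trans (p.norm_coeff_le_coeffNorm 0)

/-- The power sums of the roots of a monic polynomial are bounded in terms of the size of the
coefficients, independently of the degree. -/
theorem Polynomial.exists_norm_sum_roots_pow_le (A : ℝ) (k : ℕ) (hk : 0 < k) :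
    ∃ D : ℝ, ∀ p : ℂ[X], p.Monic → p.coeffNorm ≤ A → ‖(p.roots.map (· ^ k)).sum‖ ≤ D := by
  induction k using Nat.strong_induction_on with
  | _ k ih =>
    have ih' : ∀ j, ∃ D : ℝ, 0 < j → j < k → ∀ p : ℂ[X], p.Monic → p.coeffNorm ≤ A →
        ‖(p.roots.map (· ^ j)).sum‖ ≤ D := by
      intro j
      by_cases h : 0 < j ∧ j < k
      · obtain ⟨D, hD⟩ := ih j h.2 h.1
        exact ⟨D, fun _ _ => hD⟩
      · exact ⟨0, fun h1 h2 => absurd ⟨h1, h2⟩ h⟩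
    choose D hD using ih'
    refine ⟨k * A + ∑ a ∈ Finset.HasAntidiagonal.antidiagonal k with a.1 ∈ Set.Ioo 0 k, A * D a.2, ?_⟩
    intro p hp hA
    rw [Multiset.sum_map_pow_eq _ hk]
    refine (norm_sub_le _ _).trans (add_le_add ?_ ((norm_sum_le _ _).trans
      (Finset.sum_le_sum fun a ha => ?_)))
    · rw [norm_mul, norm_mul, norm_pow, norm_neg, norm_one, one_pow, one_mul, Complex.norm_natCast]
      gcongr
      exact (hp.norm_esymm_roots_le k).trans hA
    · rw [Finset.mem_filter, Finset.HasAntidiagonal.mem_antidiagonal, Set.mem_Ioo] at ha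
      rw [norm_mul, norm_mul, norm_pow, norm_neg, norm_one, one_pow, one_mul]
      have h1 := (hp.norm_esymm_roots_le a.1).trans hA
      exact mul_le_mul h1 (hD a.2 (by omega) (by omega) p hp hA) (norm_nonneg _)
        ((norm_nonneg _).trans h1)

/-- Landau's inequality, in the form: the roots of a monic polynomial with `|p 0| = 1` are
close to the unit circle on average. -/
theorem Polynomial.Monic.sum_abs_log_norm_roots_le {p : ℂ[X]} (hp : p.Monic)
    (h0 : ‖p.coeff 0‖ = 1) :
    (p.roots.map fun z => |Real.log ‖z‖|).sum ≤ 2 * Real.log p.coeffNorm := by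
  have hs : p.Splits := IsAlgClosed.splits p
  have hne : ∀ z ∈ p.roots, ‖z‖ ≠ 0 := by
    intro z hz hz0
    rw [norm_eq_zero] at hz0
    rw [mem_roots hp.ne_zero, hz0, IsRoot, ← coeff_zero_eq_eval_zero] at hz
    simp [hz] at h0
  have h1 : (p.roots.map fun z => Real.log ‖z‖).sum = 0 := by
    have h := hs.coeff_zero_eq_leadingCoeff_mul_prod_roots
    have h2 : (p.roots.map fun z => ‖z‖).prod = 1 := by
      have : (p.roots.map fun z => ‖z‖).prod = ‖p.roots.prod‖ :=
        (map_multiset_prod (normHom : ℂ →*₀ ℝ) p.roots).symm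
      rw [this, ← h0, h, hp.leadingCoeff]
      simp
    have h3 : ∀ s : Multiset ℂ, (∀ z ∈ s, ‖z‖ ≠ 0) →
        (s.map fun z => Real.log ‖z‖).sum = Real.log (s.map fun z => ‖z‖).prod := by
      intro s
      induction s using Multiset.induction_on with
      | empty => simp
      | cons a s ih =>
        intro h
        simp only [Multiset.map_cons, Multiset.sum_cons, Multiset.prod_cons]
        rw [ih fun z hz => h z (Multiset.mem_cons_of_mem hz), Real.log_mul
          (h a (Multiset.mem_cons_self a s)) ?_]
        rw [Ne, Multiset.prod_eq_zero_iff, Multiset.mem_map]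
        rintro ⟨z, hz, hz0⟩
        exact h z (Multiset.mem_cons_of_mem hz) hz0
    rw [h3 _ hne, h2, Real.log_one]
  have h4 : (p.roots.map fun z => Real.posLog ‖z‖).sum ≤ Real.log p.coeffNorm := by
    have h := logMahlerMeasure_eq_log_leadingCoeff_add_sum_log_roots p
    rw [hp.leadingCoeff, norm_one, Real.log_one, zero_add, logMahlerMeasure_eq_log_MahlerMeasure]
      at h
    rw [← h]
    exact Real.log_le_log (mahlerMeasure_pos_of_ne_zero hp.ne_zero)
      (mahlerMeasure_le_sum_norm_coeff p)
  have h5 : ∀ z : ℂ, |Real.log ‖z‖| = 2 * Real.posLog ‖z‖ - Real.log ‖z‖ := by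
    intro z
    rw [Real.posLog]
    rcases le_total 0 (Real.log ‖z‖) with h | h
    · rw [abs_of_nonneg h, max_eq_right h]; ring
    · rw [abs_of_nonpos h, max_eq_left h]; ring
  simp_rw [h5]
  rw [Multiset.sum_map_sub, h1, Multiset.sum_map_mul_left]
  linarith

theorem Polynomial.Monic.norm_le_coeffNorm_of_mem_roots {p : ℂ[X]} (hp : p.Monic) {z : ℂ}
    (hz : z ∈ p.roots) : ‖z‖ ≤ p.coeffNorm := by
  have h1 : (p.roots.map fun a => max 1 ‖a‖).prod ≤ p.coeffNorm :=
    (prod_max_one_norm_roots_le_mahlerMeasure_of_one_le_leadingCoeff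
      (by simp [hp.leadingCoeff])).trans (mahlerMeasure_le_sum_norm_coeff p)
  obtain ⟨s, hs⟩ := Multiset.exists_cons_of_mem hz
  rw [hs, Multiset.map_cons, Multiset.prod_cons] at h1
  have h2 : 1 ≤ (s.map fun a => max 1 ‖a‖).prod := by
    clear hs h1
    induction s using Multiset.induction_on with
    | empty => simp
    | cons a s ih =>
      rw [Multiset.map_cons, Multiset.prod_cons]
      exact one_le_mul_of_one_le_of_one_le (le_max_left _ _) ih
  calc ‖z‖ ≤ max 1 ‖z‖ := le_max_right _ _
    _ ≤ max 1 ‖z‖ * (s.map fun a => max 1 ‖a‖).prod :=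
      le_mul_of_one_le_right (by positivity) h2
    _ ≤ _ := h1

theorem Real.abs_exp_sub_one_le_mul_exp (x : ℝ) : |Real.exp x - 1| ≤ |x| * Real.exp (max 0 x) := by
  rcases le_total 0 x with h | h
  · rw [max_eq_right h, abs_of_nonneg h, abs_of_nonneg (by linarith [Real.add_one_le_exp x])]
    have := Real.add_one_le_exp (-x)
    rw [Real.exp_neg] at this
    have hp := Real.exp_pos x
    have h2 := mul_le_mul_of_nonneg_right this hp.le
    rw [inv_mul_cancel₀ hp.ne'] at h2
    linarith
  · rw [max_eq_left h, abs_of_nonpos h, Real.exp_zero, mul_one, abs_le]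
    have := Real.add_one_le_exp x
    have := Real.exp_le_one_iff.2 h
    constructor <;> linarith

/-- Moving `z` radially to the unit circle changes `z ^ k` by at most a multiple of `|log ‖z‖|`. -/
theorem Complex.norm_pow_sub_exp_arg_le {z : ℂ} (hz : z ≠ 0) {A : ℝ} (hA : 1 ≤ A) (hzA : ‖z‖ ≤ A)
    (k : ℕ) :
    ‖z ^ k - Complex.exp (k * (z.arg * Complex.I))‖ ≤ k * A ^ k * |Real.log ‖z‖| := by
  have hpos : 0 < ‖z‖ := norm_pos_iff.2 hz
  have h1 : z ^ k = ((‖z‖ ^ k : ℝ) : ℂ) * Complex.exp (k * (z.arg * Complex.I)) := by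
    conv_lhs => rw [← Complex.norm_mul_exp_arg_mul_I z]
    rw [mul_pow, ← Complex.exp_nat_mul]
    push_cast
    rfl
  have h2 : ‖Complex.exp (k * (z.arg * Complex.I))‖ = 1 := by
    have := Complex.norm_exp_ofReal_mul_I (k * z.arg)
    rw [← this]; congr 2; push_cast; ring
  have h3 : ‖z‖ ^ k = Real.exp (k * Real.log ‖z‖) := by
    rw [Real.exp_nat_mul, Real.exp_log hpos]
  have h4 : z ^ k - Complex.exp (k * (z.arg * Complex.I)) =
      ((‖z‖ ^ k - 1 : ℝ) : ℂ) * Complex.exp (k * (z.arg * Complex.I)) := by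
    rw [h1]; push_cast; ring
  rw [h4, norm_mul, h2, mul_one, Complex.norm_real, Real.norm_eq_abs, h3]
  refine (Real.abs_exp_sub_one_le_mul_exp _).trans ?_
  rw [abs_mul, abs_of_nonneg (Nat.cast_nonneg k : (0 : ℝ) ≤ k)]
  have h5 : Real.exp (max 0 (k * Real.log ‖z‖)) ≤ A ^ k := by
    rcases le_total 0 (k * Real.log ‖z‖) with h | h
    · rw [max_eq_right h, ← h3]; gcongr
    · rw [max_eq_left h, Real.exp_zero]; exact one_le_pow₀ hA
  calc k * |Real.log ‖z‖| * Real.exp (max 0 (k * Real.log ‖z‖))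
      ≤ k * |Real.log ‖z‖| * A ^ k := by gcongr
    _ = _ := by ring

theorem Multiset.norm_sum_map_sub_le {α : Type*} (s : Multiset α) (f g : α → ℂ) (h : α → ℝ)
    (hs : ∀ x ∈ s, ‖f x - g x‖ ≤ h x) :
    ‖(s.map f).sum - (s.map g).sum‖ ≤ (s.map h).sum := by
  induction s using Multiset.induction_on with
  | empty => simp
  | cons a s ih =>
    simp only [Multiset.map_cons, Multiset.sum_cons]
    have h1 := hs a (Multiset.mem_cons_self a s)
    have h2 := ih fun x hx => hs x (Multiset.mem_cons_of_mem hx)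
    calc _ = ‖(f a - g a) + ((s.map f).sum - (s.map g).sum)‖ := by congr 1; ring
      _ ≤ _ := (norm_add_le _ _).trans (add_le_add h1 h2)

/-- The exponential sums over the arguments of the roots are bounded independently of the degree. -/
theorem Polynomial.exists_norm_sum_exp_arg_roots_le (A : ℝ) (k : ℕ) (hk : 0 < k) :
    ∃ D : ℝ, ∀ p : ℂ[X], p.Monic → p.coeffNorm ≤ A → ‖p.coeff 0‖ = 1 →
      ‖(p.roots.map fun z => Complex.exp (k * (z.arg * Complex.I))).sum‖ ≤ D := by
  obtain ⟨D, hD⟩ := exists_norm_sum_roots_pow_le A k hk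
  refine ⟨D + k * A ^ k * (2 * Real.log A), fun p hp hA h0 => ?_⟩
  have h1A : 1 ≤ p.coeffNorm := h0 ▸ p.norm_coeff_le_coeffNorm 0
  have h1 := Multiset.norm_sum_map_sub_le p.roots
    (fun z => Complex.exp (k * (z.arg * Complex.I))) (· ^ k)
    (fun z => k * A ^ k * |Real.log ‖z‖|) (by
      intro z hz
      rw [norm_sub_rev]
      refine Complex.norm_pow_sub_exp_arg_le ?_ (h1A.trans hA)
        ((hp.norm_le_coeffNorm_of_mem_roots hz).trans hA) k
      rintro rfl
      rw [mem_roots hp.ne_zero, IsRoot, ← coeff_zero_eq_eval_zero] at hz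
      simp [hz] at h0)
  rw [Multiset.sum_map_mul_left] at h1
  have h2 := hp.sum_abs_log_norm_roots_le h0
  have h3 : Real.log p.coeffNorm ≤ Real.log A := Real.log_le_log (by linarith) hA
  have h4 : k * A ^ k * (p.roots.map fun z => |Real.log ‖z‖|).sum ≤
      k * A ^ k * (2 * Real.log A) := by
    have : 0 ≤ A := by linarith
    gcongr
    linarith
  have h5 := norm_sub_norm_le (p.roots.map fun z => Complex.exp (k * (z.arg * Complex.I))).sum
    (p.roots.map (· ^ k)).sum
  linarith [hD p hp hA]

/-! ### Equidistribution of the arguments of the roots -/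

instance Real.fact_two_pi_pos : Fact (0 < 2 * Real.pi) := ⟨Real.two_pi_pos⟩

theorem Complex.fourier_coe_arg (k : ℤ) (z : ℂ) :
    fourier k ((z.arg : ℝ) : AddCircle (2 * Real.pi)) = Complex.exp (k * (z.arg * Complex.I)) := by
  rw [fourier_coe_apply]
  congr 1
  have : (Real.pi : ℂ) ≠ 0 := by exact_mod_cast Real.pi_ne_zero
  push_cast
  field_simp

/-- The sum of a continuous function on the circle over the arguments of the roots of a polynomial,
as a linear functional, normalised by the degree and compared with the mean of the function. -/
noncomputable def Polynomial.argDiscrepancy (p : ℂ[X]) :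
    C(AddCircle (2 * Real.pi), ℂ) →ₗ[ℂ] ℂ where
  toFun φ := (p.roots.map fun z => φ ((z.arg : ℝ) : AddCircle (2 * Real.pi))).sum / p.natDegree -
    ∫ x, φ x ∂AddCircle.haarAddCircle
  map_add' φ ψ := by
    have h1 : Integrable (fun x => φ x) (AddCircle.haarAddCircle (T := 2 * Real.pi)) :=
      φ.continuous.integrable_of_hasCompactSupport (HasCompactSupport.of_compactSpace _)
    have h2 : Integrable (fun x => ψ x) (AddCircle.haarAddCircle (T := 2 * Real.pi)) :=
      ψ.continuous.integrable_of_hasCompactSupport (HasCompactSupport.of_compactSpace _)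
    simp only [ContinuousMap.add_apply, Multiset.sum_map_add]
    rw [integral_add h1 h2]
    ring
  map_smul' c φ := by
    simp only [ContinuousMap.smul_apply, smul_eq_mul, Multiset.sum_map_mul_left, RingHom.id_apply]
    rw [integral_const_mul]
    ring

theorem Polynomial.norm_argDiscrepancy_le (p : ℂ[X]) (φ : C(AddCircle (2 * Real.pi), ℂ)) :
    ‖p.argDiscrepancy φ‖ ≤ 2 * ‖φ‖ := by
  have h1 : ‖(p.roots.map fun z => φ ((z.arg : ℝ) : AddCircle (2 * Real.pi))).sum‖ ≤
      p.natDegree * ‖φ‖ := by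
    have h := Multiset.norm_sum_map_sub_le p.roots
      (fun z => φ ((z.arg : ℝ) : AddCircle (2 * Real.pi))) (fun _ => 0) (fun _ => ‖φ‖)
      (fun z _ => by rw [sub_zero]; exact φ.norm_coe_le_norm _)
    simp only [Multiset.map_const', Multiset.sum_replicate, nsmul_eq_mul, mul_zero, sub_zero] at h
    refine h.trans ?_
    gcongr
    exact p.card_roots'
  have h2 : ‖∫ x, φ x ∂(AddCircle.haarAddCircle (T := 2 * Real.pi))‖ ≤ ‖φ‖ := by
    refine (norm_integral_le_of_norm_le_const (C := ‖φ‖)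
      (ae_of_all _ fun x => φ.norm_coe_le_norm x)).trans (by simp)
  refine (norm_sub_le _ _).trans ?_
  rw [norm_div, Complex.norm_natCast]
  have h3 : ‖(p.roots.map fun z => φ ((z.arg : ℝ) : AddCircle (2 * Real.pi))).sum‖ / p.natDegree
      ≤ ‖φ‖ := by
    rcases Nat.eq_zero_or_pos p.natDegree with h | h
    · simp [h]
    · rw [div_le_iff₀' (by exact_mod_cast h)]; exact h1
  linarith

theorem integral_haarAddCircle_fourier {k : ℤ} (hk : k ≠ 0) :
    ∫ x, fourier k x ∂(AddCircle.haarAddCircle (T := 2 * Real.pi)) = 0 := by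
  have h := fourier_add_half_inv_index (T := 2 * Real.pi) hk Real.two_pi_pos
  have h1 := integral_add_right_eq_self (μ := AddCircle.haarAddCircle (T := 2 * Real.pi))
    (fun x => fourier k x) ((2 * Real.pi / 2 / k : ℝ) : AddCircle (2 * Real.pi))
  simp only [h, integral_neg] at h1
  exact self_eq_neg.1 h1.symm

/-- Weyl's criterion, applied to the arguments of the roots of monic polynomials of growing degree
whose coefficients stay bounded in `ℓ¹` and whose constant coefficient has modulus `1`. -/
theorem Polynomial.tendsto_argDiscrepancy {A : ℝ} {p : ℕ → ℂ[X]}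
    (hp : ∀ᶠ n in atTop, (p n).Monic ∧ (p n).coeffNorm ≤ A ∧ ‖(p n).coeff 0‖ = 1)
    (hdeg : Tendsto (fun n => (p n).natDegree) atTop atTop)
    (φ : C(AddCircle (2 * Real.pi), ℂ)) :
    Tendsto (fun n => (p n).argDiscrepancy φ) atTop (𝓝 0) := by
  have hpos : ∀ k : ℕ, 0 < k →
      Tendsto (fun n => (((p n).roots.map fun z =>
        Complex.exp (k * (z.arg * Complex.I))).sum / (p n).natDegree)) atTop (𝓝 0) := by
    intro k hk
    obtain ⟨D, hD⟩ := exists_norm_sum_exp_arg_roots_le A k hk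
    have h1 : Tendsto (fun n => D / ((p n).natDegree : ℝ)) atTop (𝓝 0) :=
      tendsto_const_nhds.div_atTop (tendsto_natCast_atTop_atTop.comp hdeg)
    refine squeeze_zero_norm' ?_ h1
    filter_upwards [hp] with n hn
    rw [norm_div, Complex.norm_natCast]
    gcongr
    exact hD _ hn.1 hn.2.1 hn.2.2
  have hfour : ∀ k : ℤ, Tendsto (fun n => (p n).argDiscrepancy (fourier k)) atTop (𝓝 0) := by
    intro k
    rcases lt_trichotomy k 0 with hk | hk | hk
    · obtain ⟨m, rfl⟩ : ∃ m : ℕ, k = -(m : ℤ) := ⟨k.natAbs, by omega⟩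
      have h := (Complex.continuous_conj.tendsto _).comp (hpos m (by omega))
      rw [map_zero] at h
      refine h.congr fun n => ?_
      simp only [argDiscrepancy, LinearMap.coe_mk, AddHom.coe_mk, Function.comp]
      rw [integral_haarAddCircle_fourier hk.ne, sub_zero, map_div₀, map_natCast,
        map_multiset_sum, Multiset.map_map]
      congr 3
      ext z
      rw [fourier_neg, Complex.fourier_coe_arg]
      simp
    · subst hk
      refine tendsto_const_nhds.congr' ?_
      filter_upwards [hdeg.eventually_gt_atTop 0] with n hn
      have hs : Multiset.card (p n).roots = (p n).natDegree :=
        (IsAlgClosed.splits (p n)).natDegree_eq_card_roots.symm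
      have : ((p n).natDegree : ℂ) ≠ 0 := by exact_mod_cast hn.ne'
      simp only [argDiscrepancy, LinearMap.coe_mk, AddHom.coe_mk, fourier_zero,
        Multiset.map_const', Multiset.sum_replicate, hs]
      simp [this]
    · obtain ⟨m, rfl⟩ : ∃ m : ℕ, k = (m : ℤ) := ⟨k.natAbs, by omega⟩
      refine (hpos m (by omega)).congr fun n => ?_
      simp only [argDiscrepancy, LinearMap.coe_mk, AddHom.coe_mk]
      rw [integral_haarAddCircle_fourier hk.ne', sub_zero]
      simp only [Complex.fourier_coe_arg, Int.cast_natCast]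
  have hspan : ∀ ψ ∈ Submodule.span ℂ (Set.range (fourier (T := 2 * Real.pi))),
      Tendsto (fun n => (p n).argDiscrepancy ψ) atTop (𝓝 0) := by
    intro ψ hψ
    induction hψ using Submodule.span_induction with
    | mem x hx => obtain ⟨k, rfl⟩ := hx; exact hfour k
    | zero => simp
    | add x y _ _ hx hy => simpa using hx.add hy
    | smul c x _ hx => simpa using hx.const_mul c
  have hφ : φ ∈ closure
      (Submodule.span ℂ (Set.range (fourier (T := 2 * Real.pi))) : Set C(_, ℂ)) := by
    rw [← Submodule.topologicalClosure_coe, span_fourier_closure_eq_top]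
    trivial
  rw [Metric.tendsto_nhds]
  intro ε hε
  obtain ⟨ψ, hψ, hd⟩ := Metric.mem_closure_iff.1 hφ (ε / 4) (by positivity)
  filter_upwards [Metric.tendsto_nhds.1 (hspan ψ hψ) (ε / 4) (by positivity)] with n hn
  rw [dist_zero_right] at hn ⊢
  have h1 := (p n).norm_argDiscrepancy_le (φ - ψ)
  rw [← dist_eq_norm φ ψ] at h1
  calc ‖(p n).argDiscrepancy φ‖
      = ‖(p n).argDiscrepancy (φ - ψ) + (p n).argDiscrepancy ψ‖ := by rw [← map_add]; simp
    _ ≤ _ := norm_add_le _ _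
    _ < ε := by linarith

/-! ### Counting on the unit circle -/

/-- If the unimodular roots lie in the closed subset `{0 ≤ H}` of the unit circle, then their
proportion is asymptotically at most the normalised measure of that set. -/
theorem Polynomial.eventually_countP_norm_eq_one_le {A : ℝ} {p : ℕ → ℂ[X]}
    (hp : ∀ᶠ n in atTop, (p n).Monic ∧ (p n).coeffNorm ≤ A ∧ ‖(p n).coeff 0‖ = 1)
    (hdeg : Tendsto (fun n => (p n).natDegree) atTop atTop)
    {H : ℂ → ℝ} (hH : Continuous H)
    (hroot : ∀ᶠ n in atTop, ∀ z ∈ (p n).roots, ‖z‖ = 1 → 0 ≤ H z) {ε : ℝ} (hε : 0 < ε) :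
    ∀ᶠ n in atTop, ((p n).roots.countP (fun z => ‖z‖ = 1) : ℝ) / (p n).natDegree ≤
      volume.real {t : ℝ | t ∈ Set.Icc 0 (2 * Real.pi) ∧ 0 ≤ H (Complex.exp (t * Complex.I))}
        / (2 * Real.pi) + ε := by
  set S := {t : ℝ | t ∈ Set.Icc 0 (2 * Real.pi) ∧ 0 ≤ H (Complex.exp (t * Complex.I))} with hS
  -- Continuous functions on the circle decreasing to the indicator of `{0 ≤ H}`.
  let g : ℕ → ℂ → ℝ := fun j z => min 1 (max 0 (1 + (j + 1) * H z))
  have hg : ∀ j, Continuous (g j) := fun j => by fun_prop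
  have hg0 : ∀ j z, 0 ≤ g j z := fun j z => le_min zero_le_one (le_max_left _ _)
  have hg1 : ∀ j z, g j z ≤ 1 := fun j z => min_le_left _ _
  have hgH : ∀ j z, 0 ≤ H z → g j z = 1 := fun j z hz =>
    min_eq_left (le_max_of_le_right (le_add_of_nonneg_right (by positivity)))
  have hgH' : ∀ z, H z < 0 → Tendsto (fun j => g j z) atTop (𝓝 0) := by
    intro z hz
    refine tendsto_const_nhds.congr' ?_
    obtain ⟨j0, hj0⟩ := exists_nat_gt (1 / -H z)
    filter_upwards [eventually_ge_atTop j0] with j hj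
    have h1 : (j0 : ℝ) ≤ j := by exact_mod_cast hj
    rw [div_lt_iff₀ (by linarith)] at hj0
    have h2 : 1 + ((j : ℝ) + 1) * H z ≤ 0 := by nlinarith
    simp only [g]
    rw [max_eq_left h2, min_eq_right zero_le_one]
  have hexp : Continuous fun t : ℝ => Complex.exp (t * Complex.I) := by fun_prop
  have hSm : MeasurableSet S :=
    (isClosed_Icc.inter (isClosed_le continuous_const (hH.comp hexp))).measurableSet
  have hlim : Tendsto (fun j => ∫ t in Set.Icc 0 (2 * Real.pi), g j (Complex.exp (t * Complex.I)))
      atTop (𝓝 (volume.real S)) := by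
    have h1 : volume.real S = ∫ t in Set.Icc 0 (2 * Real.pi), S.indicator (fun _ => (1 : ℝ)) t := by
      rw [setIntegral_indicator hSm, setIntegral_const, smul_eq_mul, mul_one]
      congr 1
      ext t
      simp only [hS, Set.mem_inter_iff]
      exact ⟨fun h => ⟨h.1, h⟩, fun h => h.2⟩
    rw [h1]
    refine tendsto_integral_of_dominated_convergence (fun _ => 1) (fun j => ?_) ?_ (fun j => ?_) ?_
    · exact ((hg j).comp hexp).aestronglyMeasurable
    · exact integrableOn_const isCompact_Icc.measure_lt_top.ne
    · refine ae_of_all _ fun t => ?_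
      rw [Real.norm_eq_abs, abs_of_nonneg (hg0 _ _)]
      exact hg1 _ _
    · rw [ae_restrict_iff' measurableSet_Icc]
      refine ae_of_all _ fun t ht => ?_
      by_cases h : 0 ≤ H (Complex.exp (t * Complex.I))
      · rw [Set.indicator_of_mem (show t ∈ S from ⟨ht, h⟩)]
        exact tendsto_const_nhds.congr fun j => (hgH j _ h).symm
      · rw [Set.indicator_of_notMem (fun h' : t ∈ S => h h'.2)]
        exact hgH' _ (not_le.1 h)
  have hpi := Real.two_pi_pos
  obtain ⟨j, hj⟩ := ((hlim.div_const (2 * Real.pi)).eventually_lt_const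
    (show volume.real S / (2 * Real.pi) < volume.real S / (2 * Real.pi) + ε / 2 by linarith)).exists
  let φ : C(AddCircle (2 * Real.pi), ℂ) :=
    ⟨fun x => (g j (AddCircle.toCircle x : ℂ) : ℂ), by
      have := (hg j).comp
        (continuous_subtype_val.comp (AddCircle.continuous_toCircle (T := 2 * Real.pi)))
      exact Complex.continuous_ofReal.comp this⟩
  have hφ : ∀ t : ℝ, φ (t : AddCircle (2 * Real.pi)) = (g j (Complex.exp (t * Complex.I)) : ℂ) := by
    intro t
    simp only [φ, ContinuousMap.coe_mk]
    rw [AddCircle.toCircle_apply_mk, Circle.coe_exp, div_self hpi.ne', one_mul]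
  have hφint : ∫ x, φ x ∂AddCircle.haarAddCircle =
      (((∫ t in Set.Icc 0 (2 * Real.pi), g j (Complex.exp (t * Complex.I))) / (2 * Real.pi) : ℝ)
        : ℂ) := by
    rw [AddCircle.integral_haarAddCircle, ← AddCircle.integral_preimage (2 * Real.pi) 0, zero_add]
    simp only [hφ]
    rw [integral_complex_ofReal, integral_Icc_eq_integral_Ioc, Complex.real_smul,
      ← Complex.ofReal_mul, div_eq_inv_mul]
  filter_upwards [hp, hroot,
    Metric.tendsto_nhds.1 (tendsto_argDiscrepancy hp hdeg φ) (ε / 2) (by positivity)]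
    with n hn hr hd
  rw [dist_zero_right] at hd
  have h2 : ((p n).argDiscrepancy φ).re =
      ((p n).roots.map fun z => g j (Complex.exp (z.arg * Complex.I))).sum / (p n).natDegree -
      (∫ t in Set.Icc 0 (2 * Real.pi), g j (Complex.exp (t * Complex.I))) / (2 * Real.pi) := by
    simp only [argDiscrepancy, LinearMap.coe_mk, AddHom.coe_mk]
    rw [hφint]
    simp only [hφ]
    have h3 : ((p n).roots.map fun z => (g j (Complex.exp (z.arg * Complex.I)) : ℂ)).sum =
        ((((p n).roots.map fun z => g j (Complex.exp (z.arg * Complex.I))).sum : ℝ) : ℂ) := by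
      have := map_multiset_sum Complex.ofRealHom
        ((p n).roots.map fun z => g j (Complex.exp (z.arg * Complex.I)))
      rw [Multiset.map_map] at this
      exact this.symm
    rw [h3, ← Complex.ofReal_natCast, ← Complex.ofReal_div, ← Complex.ofReal_sub,
      Complex.ofReal_re]
  have h4 := (abs_le.1 (Complex.abs_re_le_norm ((p n).argDiscrepancy φ))).2
  have h5 : ((p n).roots.countP (fun z => ‖z‖ = 1) : ℝ) ≤
      ((p n).roots.map fun z => g j (Complex.exp (z.arg * Complex.I))).sum := by
    clear h2 hd
    generalize (p n).roots = s at hr ⊢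
    induction s using Multiset.induction_on with
    | empty => simp
    | cons a s ih =>
      have ih' := ih fun z hz => hr z (Multiset.mem_cons_of_mem hz)
      rw [Multiset.countP_cons, Multiset.map_cons, Multiset.sum_cons]
      by_cases ha : ‖a‖ = 1
      · have h6 : Complex.exp (a.arg * Complex.I) = a := by
          have := Complex.norm_mul_exp_arg_mul_I a
          rwa [ha, Complex.ofReal_one, one_mul] at this
        rw [if_pos ha, h6, hgH j a (hr a (Multiset.mem_cons_self a s) ha)]
        push_cast
        linarith
      · rw [if_neg ha]
        have := hg0 j (Complex.exp (a.arg * Complex.I))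
        push_cast
        linarith
  have h6 : ((p n).roots.countP (fun z => ‖z‖ = 1) : ℝ) / (p n).natDegree ≤
      ((p n).roots.map fun z => g j (Complex.exp (z.arg * Complex.I))).sum / (p n).natDegree := by
    gcongr
  linarith

/-- Almost all of an open subset `{0 < h}` of `[0, 2π)` is filled by the intervals of the
subdivision of `[0, 2π)` into `M` equal parts that it contains. -/
theorem eventually_volume_le_card_mul {h : ℝ → ℝ} (hh : Continuous h) {ε : ℝ} (hε : 0 < ε) :
    ∀ᶠ M : ℕ in atTop, ∃ J ⊆ Finset.range M,
      (∀ j ∈ J, ∀ t ∈ Set.Icc (j * (2 * Real.pi / M)) ((j + 1) * (2 * Real.pi / M)), 0 < h t) ∧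
      volume.real {t : ℝ | t ∈ Set.Ico 0 (2 * Real.pi) ∧ 0 < h t} - ε ≤
        J.card * (2 * Real.pi / M) := by
  classical
  have hpi := Real.two_pi_pos
  set S := {t : ℝ | t ∈ Set.Ico 0 (2 * Real.pi) ∧ 0 < h t} with hS
  have hU : IsOpen {t | 0 < h t} := isOpen_lt continuous_const hh
  have hSm : MeasurableSet S := measurableSet_Ico.inter hU.measurableSet
  have hSfin : volume S ≠ ⊤ :=
    ((measure_mono fun t ht => Set.Ico_subset_Icc_self ht.1).trans_lt
      (isCompact_Icc (a := (0 : ℝ)) (b := 2 * Real.pi)).measure_lt_top).ne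
  obtain ⟨K, hKS, hK, hKε⟩ := hSm.exists_isCompact_lt_add hSfin
    (ε := ENNReal.ofReal ε) (by simpa using hε)
  have hKfin : volume K ≠ ⊤ := hK.measure_lt_top.ne
  have hKε' : volume.real S ≤ volume.real K + ε := by
    have := ENNReal.toReal_mono (by finiteness) hKε.le
    rwa [ENNReal.toReal_add hKfin (by simp), ENNReal.toReal_ofReal hε.le] at this
  obtain ⟨δ, hδ, hKδ⟩ := hK.exists_thickening_subset_open hU fun t ht => (hKS ht).2
  obtain ⟨M0, hM0⟩ := exists_nat_gt (2 * Real.pi / δ)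
  filter_upwards [eventually_ge_atTop M0, eventually_gt_atTop 0] with M hM hMpos
  have hMpos' : (0 : ℝ) < M := by exact_mod_cast hMpos
  set d := 2 * Real.pi / M with hd
  have hdpos : 0 < d := by positivity
  have hdδ : d < δ := by
    have : (M0 : ℝ) ≤ M := by exact_mod_cast hM
    rw [div_lt_iff₀ hδ] at hM0
    rw [hd, div_lt_iff₀ hMpos']
    nlinarith
  refine ⟨(Finset.range M).filter fun j : ℕ => ∀ t ∈ Set.Icc ((j : ℝ) * d) ((j + 1) * d), 0 < h t,
    Finset.filter_subset _ _, fun j hj => (Finset.mem_filter.1 hj).2, ?_⟩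
  set J := (Finset.range M).filter fun j : ℕ => ∀ t ∈ Set.Icc ((j : ℝ) * d) ((j + 1) * d), 0 < h t with hJ
  have hcover : K ⊆ ⋃ j ∈ J, Set.Icc ((j : ℝ) * d) ((j + 1) * d) := by
    intro t ht
    have ht0 : 0 ≤ t / d := div_nonneg (hKS ht).1.1 hdpos.le
    have h1 : (⌊t / d⌋₊ : ℝ) * d ≤ t := (le_div_iff₀ hdpos).1 (Nat.floor_le ht0)
    have h2 : t < ((⌊t / d⌋₊ : ℝ) + 1) * d := (div_lt_iff₀ hdpos).1 (Nat.lt_floor_add_one _)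
    refine Set.mem_biUnion (x := ⌊t / d⌋₊) ?_ ⟨h1, h2.le⟩
    rw [Finset.mem_coe, hJ, Finset.mem_filter, Finset.mem_range]
    refine ⟨?_, fun s hs => ?_⟩
    · rw [Nat.floor_lt ht0, div_lt_iff₀ hdpos, hd, mul_div_cancel₀ _ hMpos'.ne']
      exact (hKS ht).1.2
    · refine hKδ (Metric.mem_thickening_iff.2 ⟨t, ht, ?_⟩)
      rw [Real.dist_eq, abs_lt]
      constructor <;> linarith [hs.1, hs.2]
  have hKJ : volume.real K ≤ J.card * d := by
    calc volume.real K ≤ volume.real (⋃ j ∈ J, Set.Icc ((j : ℝ) * d) ((j + 1) * d)) :=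
          measureReal_mono hcover
            ((measure_biUnion_lt_top J.finite_toSet fun j _ => by simp).ne)
      _ ≤ ∑ j ∈ J, volume.real (Set.Icc ((j : ℝ) * d) ((j + 1) * d)) :=
          measureReal_biUnion_finset_le J _
      _ = ∑ j ∈ J, d := by
          refine Finset.sum_congr rfl fun j _ => ?_
          rw [Real.volume_real_Icc_of_le (by nlinarith)]
          ring
      _ = _ := by rw [Finset.sum_const, nsmul_eq_mul]
  linarith

/-- A compact set of reals with finitely many left endpoints of connected components is a finite
disjoint union of closed intervals. -/
theorem IsCompact.exists_eq_iUnion_Icc {T : Set ℝ} (hT : IsCompact T)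
    (hL : {x ∈ T | ∀ y < x, ¬ Set.Icc y x ⊆ T}.Finite) :
    ∃ (r : ℕ) (α β : Fin r → ℝ), (∀ i, α i ≤ β i) ∧ (∀ i j, i < j → β i < α j) ∧
      T = ⋃ i, Set.Icc (α i) (β i) := by
  obtain ⟨a, ha⟩ := hT.bddBelow
  obtain ⟨b, hb⟩ := hT.bddAbove
  -- The right endpoint of the component of `x`.
  let D : ℝ → ℝ := fun x => sSup {t | x ≤ t ∧ Set.Icc x t ⊆ T}
  have hDne : ∀ x ∈ T, x ∈ {t | x ≤ t ∧ Set.Icc x t ⊆ T} := fun x hx => ⟨le_rfl, by simpa using hx⟩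
  have hDbdd : ∀ x, BddAbove {t | x ≤ t ∧ Set.Icc x t ⊆ T} := fun x =>
    ⟨b, fun t ht => hb (ht.2 ⟨ht.1, le_rfl⟩)⟩
  have hxD : ∀ x ∈ T, x ≤ D x := fun x hx => le_csSup (hDbdd x) (hDne x hx)
  have hDT : ∀ x ∈ T, Set.Icc x (D x) ⊆ T := by
    intro x hx
    have h1 : Set.Ico x (D x) ⊆ T := by
      intro t ht
      obtain ⟨u, hu, htu⟩ := exists_lt_of_lt_csSup ⟨x, hDne x hx⟩ ht.2
      exact hu.2 ⟨ht.1, htu.le⟩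
    rcases (hxD x hx).eq_or_lt with h | h
    · rw [← h]; simpa using hx
    · rw [← closure_Ico h.ne]
      exact closure_minimal h1 hT.isClosed
  -- Every point of `T` is connected to a left endpoint of a component.
  have hleft : ∀ s ∈ T, ∃ x ∈ T, (∀ y < x, ¬ Set.Icc y x ⊆ T) ∧ x ≤ s ∧ Set.Icc x s ⊆ T := by
    intro s hs
    set W := {t | t ≤ s ∧ Set.Icc t s ⊆ T} with hW
    have hWne : s ∈ W := ⟨le_rfl, by simpa using hs⟩
    have hWb : BddBelow W := ⟨a, fun t ht => ha (ht.2 ⟨le_rfl, ht.1⟩)⟩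
    have hx : sInf W ≤ s := csInf_le hWb hWne
    have h1 : Set.Icc (sInf W) s ⊆ T := by
      have h1 : Set.Ioc (sInf W) s ⊆ T := by
        intro t ht
        obtain ⟨u, hu, htu⟩ := exists_lt_of_csInf_lt ⟨s, hWne⟩ ht.1
        exact hu.2 ⟨htu.le, ht.2⟩
      rcases hx.eq_or_lt with h | h
      · rw [h]; simpa using hs
      · rw [← closure_Ioc h.ne]
        exact closure_minimal h1 hT.isClosed
    refine ⟨sInf W, h1 ⟨le_rfl, hx⟩, fun y hy hyT => ?_, hx, h1⟩
    have : y ∈ W := ⟨hy.le.trans hx, fun t ht => by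
      rcases le_total t (sInf W) with h | h
      · exact hyT ⟨ht.1, h⟩
      · exact h1 ⟨h, ht.2⟩⟩
    exact hy.not_ge (csInf_le hWb this)
  have hmem : ∀ i, hL.toFinset.orderEmbOfFin rfl i ∈ {x ∈ T | ∀ y < x, ¬ Set.Icc y x ⊆ T} :=
    fun i => hL.mem_toFinset.1 (Finset.orderEmbOfFin_mem _ _ i)
  refine ⟨hL.toFinset.card, hL.toFinset.orderEmbOfFin rfl,
    fun i => D (hL.toFinset.orderEmbOfFin rfl i), fun i => hxD _ (hmem i).1, fun i j hij => ?_, ?_⟩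
  · have hlt : hL.toFinset.orderEmbOfFin rfl i < hL.toFinset.orderEmbOfFin rfl j :=
      (OrderEmbedding.lt_iff_lt _).2 hij
    by_contra hcon
    exact (hmem j).2 _ hlt fun t ht => hDT _ (hmem i).1 ⟨ht.1, ht.2.trans (not_lt.1 hcon)⟩
  · refine Set.Subset.antisymm (fun s hs => ?_) (Set.iUnion_subset fun i => hDT _ (hmem i).1)
    obtain ⟨x, hxT, hxl, hxs, hxsT⟩ := hleft s hs
    have hxL : x ∈ Set.range (hL.toFinset.orderEmbOfFin rfl) := by
      rw [Finset.range_orderEmbOfFin]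
      exact hL.mem_toFinset.2 ⟨hxT, hxl⟩
    obtain ⟨i, rfl⟩ := hxL
    exact Set.mem_iUnion.2 ⟨i, hxs, le_csSup (hDbdd _) ⟨hxs, hxsT⟩⟩

theorem volume_real_iUnion_Icc {r : ℕ} {α β : Fin r → ℝ} (h1 : ∀ i, α i ≤ β i)
    (h2 : ∀ i j, i < j → β i < α j) :
    volume.real (⋃ i, Set.Icc (α i) (β i)) = ∑ i, (β i - α i) := by
  have hdis : Pairwise (Function.onFun Disjoint fun i => Set.Icc (α i) (β i)) := by
    have key : ∀ i j, i < j → Disjoint (Set.Icc (α i) (β i)) (Set.Icc (α j) (β j)) := by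
      intro i j hij
      refine Set.disjoint_left.2 fun t ht ht' => ?_
      linarith [ht.2, ht'.1, h2 i j hij]
    intro i j hij
    rcases hij.lt_or_gt with h | h
    · exact key i j h
    · exact (key j i h).symm
  rw [measureReal_def, measure_iUnion hdis fun _ => measurableSet_Icc, tsum_fintype,
    ENNReal.toReal_sum fun i _ => by simp]
  exact Finset.sum_congr rfl fun i _ => by
    rw [← measureReal_def, Real.volume_real_Icc_of_le (h1 i)]

namespace LimitRatio

/-! ### Structure of the polynomials on the unit circle -/

/-- The polynomial `∑ b_j x ^ j`, whose modulus on the unit circle is the envelope. -/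
noncomputable def outerPoly (l : ℕ) (b : ℕ → ℤ) : ℂ[X] :=
  ∑ j ∈ Finset.range (l + 1), C (b j : ℂ) * X ^ j

/-- The polynomial `a_0 x ^ k + ∑ a_j (x ^ (k + j) + x ^ (k - j))`, whose modulus on the unit circle
is that of `2 f₂`. -/
noncomputable def innerPoly (k : ℕ) (a : ℕ → ℤ) : ℂ[X] :=
  C (a 0 : ℂ) * X ^ k + ∑ j ∈ Finset.Icc 1 k, C (a j : ℂ) * (X ^ (k + j) + X ^ (k - j))

/-- Reversing the order of the coefficients changes nothing, as they are symmetric. -/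
theorem sum_range_reflect_of_symm {R : Type*} [CommRing R] {l : ℕ} {b : ℕ → ℤ}
    (hb : ∀ j, j ≤ l → b j = b (l - j)) (f : ℕ → R) :
    ∑ j ∈ Finset.range (l + 1), (b j : R) * f (l - j) =
      ∑ j ∈ Finset.range (l + 1), (b j : R) * f j := by
  rw [← Finset.sum_range_reflect (fun j => (b j : R) * f j)]
  refine Finset.sum_congr rfl fun j hj => ?_
  have hj' : j ≤ l := by rw [Finset.mem_range] at hj; omega
  rw [show l + 1 - 1 - j = l - j by omega, ← hb j hj']

theorem map_poly_eq {k l n : ℕ} {a b : ℕ → ℤ} (hb : ∀ j, j ≤ l → b j = b (l - j)) (hn : k < n) :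
    (poly k l a b n).map (algebraMap ℤ ℂ) =
      (X ^ (2 * n + l) + 1) * outerPoly l b + X ^ (n + l - k) * innerPoly k a := by
  have h1 : outerPoly l b = ∑ j ∈ Finset.range (l + 1), C (b j : ℂ) * X ^ (l - j) := by
    have := sum_range_reflect_of_symm hb (fun j => (X ^ j : ℂ[X]))
    simpa [outerPoly] using this.symm
  simp only [poly, Polynomial.map_add, Polynomial.map_sum, Polynomial.map_mul, Polynomial.map_pow,
    Polynomial.map_X, Polynomial.map_C, add_mul, one_mul]
  conv_rhs => enter [1, 2]; rw [h1]
  rw [outerPoly, innerPoly, mul_add, Finset.mul_sum, Finset.mul_sum, ← Finset.sum_add_distrib,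
    ← Nat.range_succ_eq_Icc_zero, add_assoc]
  congr 1
  · refine Finset.sum_congr rfl fun j hj => ?_
    have hj' : j ≤ l := by rw [Finset.mem_range] at hj; omega
    rw [show n + l + (n + j) = 2 * n + l + j by omega, show n + l - (n + j) = l - j by omega,
      pow_add]
    simp only [algebraMap_int_eq, eq_intCast]
    ring
  · congr 1
    · rw [show n + l = n + l - k + k by omega, pow_add]
      simp only [algebraMap_int_eq, eq_intCast]
      rw [show n + l - k + k - k = n + l - k by omega]
      ring
    · refine Finset.sum_congr rfl fun j hj => ?_
      have hj' : j ≤ k := (Finset.mem_Icc.1 hj).2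
      rw [show n + l + j = n + l - k + (k + j) by omega,
        show n + l - j = n + l - k + (k - j) by omega, pow_add, pow_add]
      simp only [algebraMap_int_eq, eq_intCast]
      ring

theorem outerPoly_eq_X_pow_add {l : ℕ} {b : ℕ → ℤ} (hmonic : b l = 1) :
    outerPoly l b = X ^ l + ∑ j ∈ Finset.range l, C (b j : ℂ) * X ^ j := by
  rw [outerPoly, Finset.sum_range_succ, hmonic, add_comm]
  simp

theorem degree_sum_range_lt (l : ℕ) (b : ℕ → ℤ) :
    (∑ j ∈ Finset.range l, C (b j : ℂ) * X ^ j).degree < (l : WithBot ℕ) := by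
  rw [degree_lt_iff_coeff_zero]
  intro m hm
  rw [finsetSum_coeff]
  refine Finset.sum_eq_zero fun j hj => ?_
  rw [coeff_C_mul_X_pow, if_neg]
  rw [Finset.mem_range] at hj; omega

theorem monic_outerPoly {l : ℕ} {b : ℕ → ℤ} (hmonic : b l = 1) : (outerPoly l b).Monic := by
  rw [outerPoly_eq_X_pow_add hmonic]
  exact monic_X_pow_add (degree_sum_range_lt l b)

theorem natDegree_outerPoly {l : ℕ} {b : ℕ → ℤ} (hmonic : b l = 1) :
    (outerPoly l b).natDegree = l := by
  rw [outerPoly_eq_X_pow_add hmonic]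
  refine natDegree_eq_of_degree_eq_some ?_
  rw [degree_add_eq_left_of_degree_lt, degree_X_pow]
  rw [degree_X_pow]
  exact degree_sum_range_lt l b

theorem natDegree_innerPoly_le (k : ℕ) (a : ℕ → ℤ) : (innerPoly k a).natDegree ≤ 2 * k := by
  refine natDegree_add_le_of_degree_le ((natDegree_C_mul_X_pow_le _ _).trans (by omega))
    (natDegree_sum_le_of_forall_le _ _ fun j hj => ?_)
  have hj' : j ≤ k := (Finset.mem_Icc.1 hj).2
  refine (natDegree_C_mul_le _ _).trans (natDegree_add_le_of_degree_le ?_ ?_) <;>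
  · rw [natDegree_X_pow]; omega

theorem monic_X_pow_add_one_mul_outerPoly {l : ℕ} {b : ℕ → ℤ} (hmonic : b l = 1) {m : ℕ}
    (hm : m ≠ 0) : ((X ^ m + 1) * outerPoly l b).Monic ∧
      ((X ^ m + 1) * outerPoly l b).natDegree = m + l := by
  have h1 : (X ^ m + 1 : ℂ[X]).Monic := by simpa using monic_X_pow_add_C (1 : ℂ) hm
  have h2 : (X ^ m + 1 : ℂ[X]).natDegree = m := by
    simpa using natDegree_X_pow_add_C (n := m) (r := (1 : ℂ))
  refine ⟨h1.mul (monic_outerPoly hmonic), ?_⟩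
  rw [h1.natDegree_mul (monic_outerPoly hmonic), h2, natDegree_outerPoly hmonic]

theorem degree_X_pow_mul_innerPoly_lt {k l n : ℕ} (a b : ℕ → ℤ) (hmonic : b l = 1) (hn : k < n) :
    (X ^ (n + l - k) * innerPoly k a).degree <
      ((X ^ (2 * n + l) + 1) * outerPoly l b).degree := by
  obtain ⟨h1, h2⟩ := monic_X_pow_add_one_mul_outerPoly hmonic (m := 2 * n + l) (by omega)
  rw [degree_eq_natDegree h1.ne_zero, h2]
  refine degree_le_natDegree.trans_lt ?_
  have h3 := natDegree_mul_le (p := (X ^ (n + l - k) : ℂ[X])) (q := innerPoly k a)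
  have h4 := natDegree_innerPoly_le k a
  rw [natDegree_X_pow] at h3
  exact_mod_cast (by omega :
    (X ^ (n + l - k) * innerPoly k a).natDegree < 2 * n + l + l)

theorem monic_map_poly {k l n : ℕ} (a : ℕ → ℤ) {b : ℕ → ℤ} (hmonic : b l = 1)
    (hb : ∀ j, j ≤ l → b j = b (l - j)) (hn : k < n) :
    ((poly k l a b n).map (algebraMap ℤ ℂ)).Monic := by
  rw [map_poly_eq hb hn]
  exact (monic_X_pow_add_one_mul_outerPoly hmonic (by omega)).1.add_of_left
    (degree_X_pow_mul_innerPoly_lt a b hmonic hn)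

theorem natDegree_map_poly {k l n : ℕ} (a : ℕ → ℤ) {b : ℕ → ℤ} (hmonic : b l = 1)
    (hb : ∀ j, j ≤ l → b j = b (l - j)) (hn : k < n) :
    ((poly k l a b n).map (algebraMap ℤ ℂ)).natDegree = 2 * n + 2 * l := by
  rw [map_poly_eq hb hn, natDegree_add_eq_left_of_degree_lt
    (degree_X_pow_mul_innerPoly_lt a b hmonic hn),
    (monic_X_pow_add_one_mul_outerPoly hmonic (by omega)).2]
  ring

theorem coeff_zero_map_poly {k l n : ℕ} (a : ℕ → ℤ) {b : ℕ → ℤ} (hmonic : b l = 1)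
    (hb : ∀ j, j ≤ l → b j = b (l - j)) (hn : k < n) :
    ((poly k l a b n).map (algebraMap ℤ ℂ)).coeff 0 = 1 := by
  have h0 : b 0 = 1 := by rw [hb 0 (Nat.zero_le _), Nat.sub_zero, hmonic]
  rw [map_poly_eq hb hn, coeff_zero_eq_eval_zero, outerPoly, Finset.sum_range_succ']
  have h1 : 2 * n + l ≠ 0 := by omega
  have h2 : n + l - k ≠ 0 := by omega
  simp only [eval_add, eval_mul, eval_pow, eval_X, eval_one, eval_finsetSum, eval_C, h0,
    zero_pow h1, zero_pow h2, zero_pow (Nat.succ_ne_zero _)]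
  simp

theorem coeffNorm_map_poly_le {k l n : ℕ} (a : ℕ → ℤ) {b : ℕ → ℤ}
    (hb : ∀ j, j ≤ l → b j = b (l - j)) (hn : k < n) :
    ((poly k l a b n).map (algebraMap ℤ ℂ)).coeffNorm ≤
      2 * (outerPoly l b).coeffNorm + (innerPoly k a).coeffNorm := by
  rw [map_poly_eq hb hn, add_mul, one_mul]
  have h1 := coeffNorm_add_le (X ^ (2 * n + l) * outerPoly l b + outerPoly l b)
    (X ^ (n + l - k) * innerPoly k a)
  have h2 := coeffNorm_add_le (X ^ (2 * n + l) * outerPoly l b) (outerPoly l b)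
  have h3 := coeffNorm_X_pow_mul_le (2 * n + l) (outerPoly l b)
  have h4 := coeffNorm_X_pow_mul_le (n + l - k) (innerPoly k a)
  linarith

theorem envelope_eq_sum {l : ℕ} {b : ℕ → ℤ} (hb : ∀ j, j ≤ l → b j = b (l - j)) (t : ℝ) :
    envelope l b t = ∑ j ∈ Finset.range (l + 1), (b j : ℝ) * Real.cos (((l : ℝ) / 2 - j) * t) := by
  set c : ℕ → ℝ := fun j => (b j : ℝ) * Real.cos (((l : ℝ) / 2 - j) * t) with hc
  have hsymm : ∀ j, j ≤ l → c (l - j) = c j := by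
    intro j hj
    simp only [hc]
    rw [← hb j hj, Nat.cast_sub hj, ← Real.cos_neg]
    ring_nf
  have hsplit : ∀ q, q + q ≤ l + 1 → ∑ j ∈ Finset.range q, c (l + 1 - q + j) =
      ∑ j ∈ Finset.range q, c j := by
    intro q hq
    rw [← Finset.sum_range_reflect]
    refine Finset.sum_congr rfl fun j hj => ?_
    rw [Finset.mem_range] at hj
    rw [← hsymm j (by omega)]
    congr 1
    omega
  have hmul : ∀ q, ∑ j ∈ Finset.range q, 2 * (b j : ℝ) * Real.cos (((l : ℝ) / 2 - j) * t) =
      2 * ∑ j ∈ Finset.range q, c j := by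
    intro q
    rw [Finset.mul_sum]
    exact Finset.sum_congr rfl fun j _ => mul_assoc _ _ _
  rw [envelope]
  split_ifs with h
  · obtain ⟨q, hq⟩ := h
    rw [hmul, show l / 2 = q by omega, show l + 1 = (q + 1) + q by omega, Finset.sum_range_add,
      Finset.sum_range_succ c]
    have h1 := hsplit q (by omega)
    rw [show l + 1 - q = q + 1 by omega] at h1
    rw [h1]
    have h2 : c q = b q := by
      simp only [hc]
      rw [hq]
      push_cast
      rw [show ((q : ℝ) + q) / 2 - q = 0 by ring]
      simp
    rw [h2]
    ring
  · obtain ⟨q, hq⟩ := Nat.not_even_iff_odd.1 h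
    rw [hmul, show (l + 1) / 2 = q + 1 by omega, show l + 1 = (q + 1) + (q + 1) by omega,
      Finset.sum_range_add c (q + 1) (q + 1)]
    have h1 := hsplit (q + 1) (by omega)
    rw [show l + 1 - (q + 1) = q + 1 by omega] at h1
    rw [h1]
    ring

theorem eval_outerPoly_exp {l : ℕ} {b : ℕ → ℤ} (hb : ∀ j, j ≤ l → b j = b (l - j)) (t : ℝ) :
    (outerPoly l b).eval (Complex.exp (t * Complex.I)) =
      Complex.exp (((l : ℝ) / 2 * t : ℝ) * Complex.I) * (envelope l b t : ℂ) := by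
  have hsin : ∑ j ∈ Finset.range (l + 1), (b j : ℝ) * Real.sin (((l : ℝ) / 2 - j) * t) = 0 := by
    have h := sum_range_reflect_of_symm hb
      (fun j => Real.sin (((l : ℝ) / 2 - j) * t))
    have h2 : ∑ j ∈ Finset.range (l + 1), (b j : ℝ) * Real.sin (((l : ℝ) / 2 - (l - j : ℕ)) * t) =
        -∑ j ∈ Finset.range (l + 1), (b j : ℝ) * Real.sin (((l : ℝ) / 2 - j) * t) := by
      rw [← Finset.sum_neg_distrib]
      refine Finset.sum_congr rfl fun j hj => ?_
      rw [Nat.cast_sub (by rw [Finset.mem_range] at hj; omega), ← mul_neg, ← Real.sin_neg]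
      ring_nf
    linarith
  have hsum : (envelope l b t : ℂ) =
      ∑ j ∈ Finset.range (l + 1), (b j : ℂ) *
        Complex.exp (-((((l : ℝ) / 2 - j) * t : ℝ) : ℂ) * Complex.I) := by
    have h1 : ∀ x : ℝ, Complex.exp (-(x : ℂ) * Complex.I) =
        (Real.cos x : ℂ) - (Real.sin x : ℂ) * Complex.I := by
      intro x
      rw [Complex.exp_mul_I, Complex.cos_neg, Complex.sin_neg, Complex.ofReal_cos,
        Complex.ofReal_sin]
      ring
    simp_rw [h1, mul_sub, Finset.sum_sub_distrib, ← mul_assoc, ← Finset.sum_mul]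
    have h2 := congrArg (Complex.ofReal) hsin
    have h3 := congrArg (Complex.ofReal) (envelope_eq_sum hb t)
    rw [Complex.ofReal_sum] at h2 h3
    simp only [Complex.ofReal_mul, Complex.ofReal_intCast, Complex.ofReal_zero] at h2 h3
    rw [h2, h3]
    simp
  rw [hsum, Finset.mul_sum, outerPoly, eval_finsetSum]
  refine Finset.sum_congr rfl fun j _ => ?_
  rw [eval_mul, eval_C, eval_pow, eval_X, ← Complex.exp_nat_mul,
    mul_left_comm (Complex.exp _), ← Complex.exp_add]
  congr 2
  push_cast
  ring

theorem eval_innerPoly_exp (k : ℕ) (a : ℕ → ℤ) (t : ℝ) :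
    (innerPoly k a).eval (Complex.exp (t * Complex.I)) =
      -2 * Complex.exp ((k * t : ℝ) * Complex.I) * (f₂ k a t : ℂ) := by
  have hexp : ∀ m : ℕ, Complex.exp (t * Complex.I) ^ m = Complex.exp ((m * t : ℝ) * Complex.I) := by
    intro m
    rw [← Complex.exp_nat_mul]
    congr 1
    push_cast
    ring
  rw [f₂, innerPoly, eval_add, eval_finsetSum]
  push_cast
  rw [mul_sub, Finset.mul_sum, sub_eq_add_neg, ← Finset.sum_neg_distrib]
  congr 1
  · rw [eval_mul, eval_C, eval_pow, eval_X, hexp]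
    push_cast
    ring
  · refine Finset.sum_congr rfl fun j hj => ?_
    have hj' : j ≤ k := (Finset.mem_Icc.1 hj).2
    rw [eval_mul, eval_C, eval_add, eval_pow, eval_pow, eval_X, hexp, hexp, Complex.cos]
    rw [Nat.cast_sub hj']
    push_cast
    rw [show ((k : ℂ) + j) * t * Complex.I = k * t * Complex.I + j * t * Complex.I by ring,
      show ((k : ℂ) - j) * t * Complex.I = k * t * Complex.I + -(j * t) * Complex.I by ring,
      Complex.exp_add, Complex.exp_add]
    ring

/-- On the unit circle the polynomial is `2 (E(t) cos ((n + l / 2) t) - f₂(t))` up to a factor of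
modulus `1`. -/
theorem eval_map_poly_exp {k l n : ℕ} (a : ℕ → ℤ) {b : ℕ → ℤ}
    (hb : ∀ j, j ≤ l → b j = b (l - j)) (hn : k < n) (t : ℝ) :
    ((poly k l a b n).map (algebraMap ℤ ℂ)).eval (Complex.exp (t * Complex.I)) =
      2 * Complex.exp (((n + l) * t : ℝ) * Complex.I) *
        ((envelope l b t * Real.cos ((2 * n + l : ℕ) * t / 2) - f₂ k a t : ℝ) : ℂ) := by
  rw [map_poly_eq hb hn]
  simp only [eval_add, eval_mul, eval_pow, eval_X, eval_one]
  rw [eval_outerPoly_exp hb, eval_innerPoly_exp, ← Complex.exp_nat_mul, ← Complex.exp_nat_mul]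
  set u := Complex.exp (((n + (l : ℝ) / 2) * t : ℝ) * Complex.I) with hu
  have h1 : Complex.exp ((2 * n + l : ℕ) * (t * Complex.I)) = u * u := by
    rw [hu, ← Complex.exp_add]; congr 1; push_cast; ring
  have h2 : (Real.cos ((2 * n + l : ℕ) * t / 2) : ℂ) = (u + u⁻¹) / 2 := by
    rw [Complex.ofReal_cos, Complex.cos, hu, ← Complex.exp_neg]
    congr 3 <;> · push_cast; ring
  have h3 : Complex.exp (((n + l) * t : ℝ) * Complex.I) =
      u * Complex.exp (((l : ℝ) / 2 * t : ℝ) * Complex.I) := by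
    rw [hu, ← Complex.exp_add]; congr 1; push_cast; ring
  have h4 : Complex.exp ((n + l - k : ℕ) * (t * Complex.I)) * Complex.exp ((k * t : ℝ) * Complex.I) =
      Complex.exp (((n + l) * t : ℝ) * Complex.I) := by
    rw [← Complex.exp_add, Nat.cast_sub (by omega)]; congr 1; push_cast; ring
  have hu0 : u ≠ 0 := Complex.exp_ne_zero _
  rw [h1]
  have h5 : Complex.exp ((n + l - k : ℕ) * (t * Complex.I)) *
      (-2 * Complex.exp ((k * t : ℝ) * Complex.I) * (f₂ k a t : ℂ)) =
      -2 * Complex.exp (((n + l) * t : ℝ) * Complex.I) * (f₂ k a t : ℂ) := by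
    rw [← h4]; ring
  rw [h5, Complex.ofReal_sub, Complex.ofReal_mul (envelope l b t), h2, mul_sub, sub_eq_add_neg]
  congr 1
  · rw [h3]; field_simp
  · ring

/-! ### The set where `f₂` is dominated by the envelope -/

theorem exp_mul_I_injOn :
    Set.InjOn (fun t : ℝ => Complex.exp (t * Complex.I)) (Set.Ico 0 (2 * Real.pi)) := by
  intro s hs t ht hst
  obtain ⟨m, hm⟩ := Complex.exp_eq_exp_iff_exists_int.1 hst
  have h1 : (s : ℂ) = t + m * (2 * Real.pi) := by
    apply mul_right_cancel₀ Complex.I_ne_zero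
    rw [hm]; ring
  have h2 : s = t + m * (2 * Real.pi) := by exact_mod_cast h1
  have hpi := Real.two_pi_pos
  have h3 : (m : ℝ) < 1 := by
    by_contra h
    nlinarith [hs.2, ht.1, not_lt.1 h]
  have h4 : (-1 : ℝ) < m := by
    by_contra h
    nlinarith [hs.1, ht.2, not_lt.1 h]
  have h5 : m = 0 := by
    have : m < 1 := by exact_mod_cast h3
    have : -1 < m := by exact_mod_cast h4
    omega
  simpa [h5] using h2

/-- The function on the plane which on the unit circle equals `4 (E ^ 2 - f₂ ^ 2)`. -/
noncomputable def gap (k l : ℕ) (a b : ℕ → ℤ) (z : ℂ) : ℝ :=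
  4 * ‖(outerPoly l b).eval z‖ ^ 2 - ‖(innerPoly k a).eval z‖ ^ 2

theorem continuous_gap (k l : ℕ) (a b : ℕ → ℤ) : Continuous (gap k l a b) := by
  unfold gap
  fun_prop

theorem gap_exp {l : ℕ} (k : ℕ) (a : ℕ → ℤ) {b : ℕ → ℤ} (hb : ∀ j, j ≤ l → b j = b (l - j))
    (t : ℝ) :
    gap k l a b (Complex.exp (t * Complex.I)) = 4 * (envelope l b t ^ 2 - f₂ k a t ^ 2) := by
  rw [gap, eval_outerPoly_exp hb, eval_innerPoly_exp]
  simp only [norm_mul, norm_neg, Complex.norm_exp_ofReal_mul_I, Complex.norm_real,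
    Real.norm_eq_abs, mul_pow, sq_abs]
  norm_num
  ring

theorem abs_f₂_le_iff {l : ℕ} (k : ℕ) (a : ℕ → ℤ) {b : ℕ → ℤ}
    (hb : ∀ j, j ≤ l → b j = b (l - j)) (t : ℝ) :
    |f₂ k a t| ≤ |envelope l b t| ↔ 0 ≤ gap k l a b (Complex.exp (t * Complex.I)) := by
  rw [gap_exp k a hb, ← sq_le_sq]
  constructor <;> intro h <;> linarith

theorem abs_f₂_lt_iff {l : ℕ} (k : ℕ) (a : ℕ → ℤ) {b : ℕ → ℤ}
    (hb : ∀ j, j ≤ l → b j = b (l - j)) (t : ℝ) :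
    |f₂ k a t| < |envelope l b t| ↔ 0 < gap k l a b (Complex.exp (t * Complex.I)) := by
  rw [gap_exp k a hb, ← sq_lt_sq]
  constructor <;> intro h <;> linarith

/-- The polynomial which on the unit circle is `x ^ (l + 2 k)` times `4 (E ^ 2 - f₂ ^ 2)`. -/
noncomputable def gapPoly (k l : ℕ) (a b : ℕ → ℤ) : ℂ[X] :=
  (C 2 * X ^ k * outerPoly l b) ^ 2 - X ^ l * innerPoly k a ^ 2

theorem eval_gapPoly_exp {l : ℕ} (k : ℕ) (a : ℕ → ℤ) {b : ℕ → ℤ}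
    (hb : ∀ j, j ≤ l → b j = b (l - j)) (t : ℝ) :
    (gapPoly k l a b).eval (Complex.exp (t * Complex.I)) =
      Complex.exp (t * Complex.I) ^ (l + 2 * k) *
        (gap k l a b (Complex.exp (t * Complex.I)) : ℂ) := by
  rw [gap_exp k a hb, gapPoly]
  simp only [eval_sub, eval_mul, eval_pow, eval_X, eval_C]
  rw [eval_outerPoly_exp hb, eval_innerPoly_exp]
  set z := Complex.exp (t * Complex.I) with hz
  have h1 : Complex.exp (((l : ℝ) / 2 * t : ℝ) * Complex.I) ^ 2 = z ^ l := by
    rw [hz, ← Complex.exp_nat_mul, ← Complex.exp_nat_mul]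
    congr 1
    push_cast
    ring
  have h2 : Complex.exp ((k * t : ℝ) * Complex.I) = z ^ k := by
    rw [hz, ← Complex.exp_nat_mul]
    congr 1
    push_cast
    ring
  rw [mul_pow, mul_pow _ (envelope l b t : ℂ), h1, h2]
  push_cast
  ring

theorem gap_eq_zero_iff {l : ℕ} (k : ℕ) (a : ℕ → ℤ) {b : ℕ → ℤ}
    (hb : ∀ j, j ≤ l → b j = b (l - j)) (t : ℝ) :
    gap k l a b (Complex.exp (t * Complex.I)) = 0 ↔
      (gapPoly k l a b).eval (Complex.exp (t * Complex.I)) = 0 := by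
  rw [eval_gapPoly_exp k a hb]
  simp [Complex.exp_ne_zero]

theorem finite_gap_eq_zero {l k : ℕ} {a : ℕ → ℤ} {b : ℕ → ℤ}
    (hb : ∀ j, j ≤ l → b j = b (l - j)) (hG : gapPoly k l a b ≠ 0) :
    {t : ℝ | t ∈ Set.Icc 0 (2 * Real.pi) ∧ gap k l a b (Complex.exp (t * Complex.I)) = 0}.Finite := by
  have h1 : (Set.Ico 0 (2 * Real.pi) ∩ (fun t : ℝ => Complex.exp (t * Complex.I)) ⁻¹'
      {z | (gapPoly k l a b).IsRoot z}).Finite := by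
    refine Set.Finite.of_finite_image ((finite_setOfPred_isRoot hG).subset ?_)
      (exp_mul_I_injOn.mono Set.inter_subset_left)
    rintro _ ⟨t, ht, rfl⟩
    exact ht.2
  refine (h1.union (Set.finite_singleton (2 * Real.pi))).subset ?_
  rintro t ⟨ht, ht0⟩
  rcases ht.2.eq_or_lt with h | h
  · exact Or.inr h
  · exact Or.inl ⟨⟨ht.1, h⟩, (gap_eq_zero_iff k a hb t).1 ht0⟩

/-- The set of those `t ∈ [0, 2π]` with `|f₂ t| ≤ |E t|`, written with `gap`. -/
noncomputable def dominatedSet (k l : ℕ) (a b : ℕ → ℤ) : Set ℝ :=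
  {t : ℝ | t ∈ Set.Icc 0 (2 * Real.pi) ∧ 0 ≤ gap k l a b (Complex.exp (t * Complex.I))}

theorem continuous_gap_exp (k l : ℕ) (a b : ℕ → ℤ) :
    Continuous fun t : ℝ => gap k l a b (Complex.exp (t * Complex.I)) :=
  (continuous_gap k l a b).comp (by fun_prop)

theorem isCompact_dominatedSet (k l : ℕ) (a b : ℕ → ℤ) : IsCompact (dominatedSet k l a b) :=
  isCompact_Icc.inter_right (isClosed_le continuous_const (continuous_gap_exp k l a b))

theorem dominatedSet_eq_Icc {l k : ℕ} {a : ℕ → ℤ} {b : ℕ → ℤ}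
    (hb : ∀ j, j ≤ l → b j = b (l - j)) (hG : gapPoly k l a b = 0) :
    dominatedSet k l a b = Set.Icc 0 (2 * Real.pi) := by
  ext t
  refine ⟨fun h => h.1, fun h => ⟨h, ?_⟩⟩
  rw [(gap_eq_zero_iff k a hb t).2 (by simp [hG])]

/-- A left endpoint of a component of `dominatedSet` is `0` or a zero of the gap; this is what makes
the number of components finite. -/
theorem finite_left_endpoints_dominatedSet {l : ℕ} (k : ℕ) (a : ℕ → ℤ) {b : ℕ → ℤ}
    (hb : ∀ j, j ≤ l → b j = b (l - j)) :
    {x ∈ dominatedSet k l a b | ∀ y < x, ¬ Set.Icc y x ⊆ dominatedSet k l a b}.Finite := by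
  by_cases hG : gapPoly k l a b = 0
  · rw [dominatedSet_eq_Icc hb hG]
    refine (Set.finite_singleton (0 : ℝ)).subset ?_
    rintro x ⟨hx, hxl⟩
    by_contra h0
    exact hxl 0 (lt_of_le_of_ne hx.1 (Ne.symm h0)) (Set.Icc_subset_Icc le_rfl hx.2)
  · refine ((Set.finite_singleton (0 : ℝ)).union (finite_gap_eq_zero hb hG)).subset ?_
    rintro x ⟨hx, hxl⟩
    by_contra hcon
    rw [Set.mem_union, not_or] at hcon
    have hx0 : 0 < x := lt_of_le_of_ne hx.1.1 (Ne.symm hcon.1)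
    have hgx : 0 < gap k l a b (Complex.exp (x * Complex.I)) :=
      lt_of_le_of_ne hx.2 fun h => hcon.2 ⟨hx.1, h.symm⟩
    obtain ⟨δ, hδ, hball⟩ := Metric.isOpen_iff.1
      (isOpen_lt continuous_const (continuous_gap_exp k l a b)) x hgx
    refine hxl (max 0 (x - δ / 2)) (max_lt hx0 (by linarith)) fun t ht => ?_
    have h1 := (max_le_iff.1 ht.1)
    refine ⟨⟨h1.1, ht.2.trans hx.1.2⟩, le_of_lt (hball (a := t) ?_)⟩
    rw [Metric.mem_ball, Real.dist_eq, abs_lt]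
    constructor <;> linarith [ht.2]

/-! ### Counting the unimodular zeros -/

theorem numUnimodular_eq (p : ℤ[X]) :
    numUnimodular p = (p.map (algebraMap ℤ ℂ)).roots.countP (fun z => ‖z‖ = 1) := rfl

theorem ratio_eq_one_sub {p : ℤ[X]} (hp : 0 < p.natDegree) :
    ratio p = 1 - (numUnimodular p : ℝ) / p.natDegree := by
  have h1 : ∀ s : Multiset ℂ, s.countP (fun z => ‖z‖ < 1) + s.countP (fun z => ‖z‖ = 1) +
      s.countP (fun z => 1 < ‖z‖) = Multiset.card s := by
    intro s
    induction s using Multiset.induction_on with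
    | empty => simp
    | cons z s ih =>
      simp only [Multiset.countP_cons, Multiset.card_cons]
      rcases lt_trichotomy ‖z‖ 1 with h | h | h
      · rw [if_pos h, if_neg h.ne, if_neg h.not_gt]; omega
      · rw [if_neg h.not_lt, if_pos h, if_neg h.not_gt]; omega
      · rw [if_neg h.not_gt, if_neg h.ne', if_pos h]; omega
  have h2 : Multiset.card (p.aroots ℂ) = p.natDegree := by
    rw [aroots, ← (IsAlgClosed.splits (p.map (algebraMap ℤ ℂ))).natDegree_eq_card_roots]
    exact natDegree_map_eq_of_injective (algebraMap ℤ ℂ).injective_int p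
  have h3 : (numInside p : ℝ) + numUnimodular p + numOutside p = p.natDegree := by
    rw [← h2]
    exact_mod_cast h1 (p.aroots ℂ)
  have h4 : (p.natDegree : ℝ) ≠ 0 := by exact_mod_cast hp.ne'
  rw [ratio, eq_sub_iff_add_eq, ← add_div, div_eq_one_iff_eq h4]
  linarith

/-- On each interval between consecutive extrema of `cos ((n + l / 2) t)` on which
`|f₂| < |E|` there is a zero. -/
theorem exists_root_of_abs_f₂_lt {k l n : ℕ} (a : ℕ → ℤ) {b : ℕ → ℤ}
    (hb : ∀ j, j ≤ l → b j = b (l - j)) (hn : k < n) (j : ℕ)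
    (h : ∀ t ∈ Set.Icc (j * (2 * Real.pi / (2 * n + l : ℕ)))
      ((j + 1) * (2 * Real.pi / (2 * n + l : ℕ))),
      0 < gap k l a b (Complex.exp (t * Complex.I))) :
    ∃ t ∈ Set.Ioo (j * (2 * Real.pi / (2 * n + l : ℕ))) ((j + 1) * (2 * Real.pi / (2 * n + l : ℕ))),
      ((poly k l a b n).map (algebraMap ℤ ℂ)).eval (Complex.exp (t * Complex.I)) = 0 := by
  have hM : (0 : ℝ) < (2 * n + l : ℕ) := by exact_mod_cast (by omega : 0 < 2 * n + l)
  set M : ℝ := ((2 * n + l : ℕ) : ℝ) with hMdef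
  set d := 2 * Real.pi / M with hd
  have hdpos : 0 < d := div_pos Real.two_pi_pos hM
  have hle : (j : ℝ) * d ≤ (j + 1) * d := by nlinarith
  have hlt : ∀ t ∈ Set.Icc (j * d) ((j + 1) * d), |f₂ k a t| < |envelope l b t| :=
    fun t ht => (abs_f₂_lt_iff k a hb t).2 (h t ht)
  have hE : ∀ t ∈ Set.Icc (j * d) ((j + 1) * d), envelope l b t ≠ 0 := fun t ht =>
    abs_pos.1 ((abs_nonneg _).trans_lt (hlt t ht))
  have hEc : Continuous (envelope l b) := by
    rw [funext (envelope_eq_sum hb)]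
    fun_prop
  have hfc : Continuous (f₂ k a) := by
    unfold f₂
    fun_prop
  -- Dividing by `E`, which has no zero here, leaves `cos` minus a function of modulus `< 1`, and
  -- `cos` takes the values `±1`, with opposite signs, at the endpoints.
  set g : ℝ → ℝ := fun t => Real.cos (M * t / 2) - f₂ k a t / envelope l b t with hg
  have hgc : ContinuousOn g (Set.Icc (j * d) ((j + 1) * d)) := by
    refine ContinuousOn.sub (by fun_prop) ?_
    exact hfc.continuousOn.div hEc.continuousOn hE
  have hr : ∀ t ∈ Set.Icc (j * d) ((j + 1) * d), |f₂ k a t / envelope l b t| < 1 := by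
    intro t ht
    rw [abs_div, div_lt_one (abs_pos.2 (hE t ht))]
    exact hlt t ht
  have hcos : ∀ i : ℕ, Real.cos (M * (i * d) / 2) = (-1) ^ i := by
    intro i
    rw [← Real.cos_nat_mul_pi, hd]
    congr 1
    field_simp
  have hl := abs_lt.1 (hr _ ⟨le_rfl, hle⟩)
  have hu := abs_lt.1 (hr _ ⟨hle, le_rfl⟩)
  have hcos1 := hcos j
  have hcos2 := hcos (j + 1)
  push_cast at hcos2
  have hzero : ∃ t ∈ Set.Ioo (j * d) ((j + 1) * d), g t = 0 := by
    rcases Nat.even_or_odd j with hj | hj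
    · rw [hj.neg_one_pow] at hcos1
      rw [hj.add_one.neg_one_pow] at hcos2
      refine intermediate_value_Ioo' hle hgc ⟨?_, ?_⟩
      · simp only [hg]; rw [hcos2]; linarith
      · simp only [hg]; rw [hcos1]; linarith
    · rw [hj.neg_one_pow] at hcos1
      rw [hj.add_one.neg_one_pow] at hcos2
      refine intermediate_value_Ioo hle hgc ⟨?_, ?_⟩
      · simp only [hg]; rw [hcos1]; linarith
      · simp only [hg]; rw [hcos2]; linarith
  obtain ⟨t, ht, htg⟩ := hzero
  refine ⟨t, ht, ?_⟩
  have hEt := hE t (Set.Ioo_subset_Icc_self ht)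
  have h1 : envelope l b t * Real.cos (M * t / 2) - f₂ k a t = 0 := by
    have h2 : envelope l b t * g t = 0 := by rw [htg, mul_zero]
    simp only [hg] at h2
    rwa [mul_sub, mul_div_cancel₀ _ hEt] at h2
  rw [eval_map_poly_exp a hb hn, ← hMdef, h1]
  simp

/-- The zeros found in different intervals are different, so `J` bounds their number from below. -/
theorem card_le_numUnimodular {k l n : ℕ} (a : ℕ → ℤ) {b : ℕ → ℤ} (hmonic : b l = 1)
    (hb : ∀ j, j ≤ l → b j = b (l - j)) (hn : k < n) {J : Finset ℕ}
    (hJ : J ⊆ Finset.range (2 * n + l))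
    (h : ∀ j ∈ J, ∀ t ∈ Set.Icc (j * (2 * Real.pi / (2 * n + l : ℕ)))
      ((j + 1) * (2 * Real.pi / (2 * n + l : ℕ))),
      0 < gap k l a b (Complex.exp (t * Complex.I))) :
    J.card ≤ numUnimodular (poly k l a b n) := by
  classical
  have hM : (0 : ℝ) < (2 * n + l : ℕ) := by exact_mod_cast (by omega : 0 < 2 * n + l)
  have h' : ∀ j : ℕ, ∃ t : ℝ, j ∈ J → t ∈ Set.Ioo (j * (2 * Real.pi / (2 * n + l : ℕ)))
      ((j + 1) * (2 * Real.pi / (2 * n + l : ℕ))) ∧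
      ((poly k l a b n).map (algebraMap ℤ ℂ)).eval (Complex.exp (t * Complex.I)) = 0 := by
    intro j
    by_cases hj : j ∈ J
    · obtain ⟨t, ht, ht'⟩ := exists_root_of_abs_f₂_lt a hb hn j (h j hj)
      exact ⟨t, fun _ => ⟨ht, ht'⟩⟩
    · exact ⟨0, fun h => absurd h hj⟩
  choose t ht using h'
  set d := 2 * Real.pi / (2 * n + l : ℕ) with hd
  have hdpos : 0 < d := div_pos Real.two_pi_pos hM
  have htI : ∀ j ∈ J, t j ∈ Set.Ico 0 (2 * Real.pi) := by
    intro j hj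
    have h1 := (ht j hj).1
    have h2 : (j : ℝ) + 1 ≤ (2 * n + l : ℕ) := by
      exact_mod_cast Finset.mem_range.1 (hJ hj)
    have h3 : ((2 * n + l : ℕ) : ℝ) * d = 2 * Real.pi := mul_div_cancel₀ _ hM.ne'
    have h4 : (0 : ℝ) ≤ j * d := by positivity
    exact ⟨h4.trans h1.1.le, h1.2.trans_le (by nlinarith)⟩
  have hlt : ∀ i ∈ J, ∀ j ∈ J, i < j → t i < t j := by
    intro i hi j hj hij
    have h1 : (i : ℝ) + 1 ≤ j := by exact_mod_cast hij
    have h2 := (ht i hi).1.2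
    have h3 := (ht j hj).1.1
    nlinarith
  have hinj : Set.InjOn (fun j => Complex.exp (t j * Complex.I)) J := by
    intro i hi j hj hij
    have h1 : t i = t j := exp_mul_I_injOn (htI i hi) (htI j hj) hij
    by_contra hne
    rcases Ne.lt_or_gt hne with h2 | h2
    · exact (hlt i hi j hj h2).ne h1
    · exact (hlt j hj i hi h2).ne h1.symm
  rw [numUnimodular_eq, Multiset.countP_eq_card_filter, ← Finset.card_image_of_injOn hinj]
  refine (Finset.card_le_card fun z hz => ?_).trans (Multiset.toFinset_card_le _)
  obtain ⟨j, hj, rfl⟩ := Finset.mem_image.1 hz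
  rw [Multiset.mem_toFinset, Multiset.mem_filter,
    mem_roots (monic_map_poly a hmonic hb hn).ne_zero]
  exact ⟨(ht j hj).2, Complex.norm_exp_ofReal_mul_I _⟩

/-- The set where `|f₂| = |E|` is negligible unless it is everything. -/
theorem volume_dominatedSet_le {l k : ℕ} {a : ℕ → ℤ} {b : ℕ → ℤ}
    (hb : ∀ j, j ≤ l → b j = b (l - j)) (hG : gapPoly k l a b ≠ 0) :
    volume.real (dominatedSet k l a b) ≤ volume.real {t : ℝ | t ∈ Set.Ico 0 (2 * Real.pi) ∧
      0 < gap k l a b (Complex.exp (t * Complex.I))} := by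
  set S := {t : ℝ | t ∈ Set.Ico 0 (2 * Real.pi) ∧ 0 < gap k l a b (Complex.exp (t * Complex.I))}
  set N := {t : ℝ | t ∈ Set.Icc 0 (2 * Real.pi) ∧ gap k l a b (Complex.exp (t * Complex.I)) = 0}
    ∪ {2 * Real.pi}
  have hN : volume N = 0 :=
    ((finite_gap_eq_zero hb hG).union (Set.finite_singleton _)).measure_zero _
  have hS : volume S ≠ ⊤ := ((measure_mono fun t ht => Set.Ico_subset_Icc_self ht.1).trans_lt
    (isCompact_Icc (a := (0 : ℝ)) (b := 2 * Real.pi)).measure_lt_top).ne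
  have hsub : dominatedSet k l a b ⊆ S ∪ N := by
    rintro t ⟨ht, ht0⟩
    rcases ht.2.eq_or_lt with h | h
    · exact Or.inr (Or.inr h)
    rcases ht0.eq_or_lt with h' | h'
    · exact Or.inr (Or.inl ⟨ht, h'.symm⟩)
    · exact Or.inl ⟨⟨ht.1, h⟩, h'⟩
  refine ENNReal.toReal_mono hS ((measure_mono hsub).trans ((measure_union_le _ _).trans ?_))
  rw [hN, add_zero]

/-- If `|f₂| = |E|` identically, then `l = 2 q` and the polynomial is
`(∑ b_j x ^ j) (x ^ (n + q) ± 1) ^ 2`. -/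
theorem exists_map_poly_eq_of_gapPoly_eq_zero {l k : ℕ} {a : ℕ → ℤ} {b : ℕ → ℤ} (hmonic : b l = 1)
    (hb : ∀ j, j ≤ l → b j = b (l - j)) (hG : gapPoly k l a b = 0) :
    ∃ (q : ℕ) (s : ℂ), l = 2 * q ∧ ‖s‖ = 1 ∧ ∀ n, k < n →
      (poly k l a b n).map (algebraMap ℤ ℂ) = outerPoly l b * (X ^ (n + q) + C s) ^ 2 := by
  have hB := monic_outerPoly hmonic
  have h1 : (C 2 * X ^ k * outerPoly l b) ^ 2 = X ^ l * innerPoly k a ^ 2 := sub_eq_zero.1 hG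
  have hL : C 2 * X ^ k * outerPoly l b ≠ 0 :=
    mul_ne_zero (mul_ne_zero (by simp) (pow_ne_zero _ X_ne_zero)) hB.ne_zero
  have hA : innerPoly k a ≠ 0 := by
    intro h
    rw [h] at h1
    exact pow_ne_zero 2 hL (by simpa using h1)
  obtain ⟨q, hq⟩ : ∃ q, l = 2 * q := by
    have h2 := congrArg natDegree h1
    rw [natDegree_pow, natDegree_mul (pow_ne_zero _ X_ne_zero) (pow_ne_zero _ hA), natDegree_pow,
      natDegree_pow, natDegree_X] at h2
    exact ⟨l / 2, by omega⟩
  have h2 : (X ^ q * innerPoly k a) ^ 2 = (C 2 * X ^ k * outerPoly l b) ^ 2 := by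
    rw [h1, mul_pow, ← pow_mul, hq, mul_comm q 2]
  obtain ⟨s, hs1, hs2, hs3⟩ : ∃ s : ℂ, ‖s‖ = 1 ∧ s ^ 2 = 1 ∧
      X ^ q * innerPoly k a = C s * (C 2 * X ^ k * outerPoly l b) := by
    rcases sq_eq_sq_iff_eq_or_eq_neg.1 h2 with h | h
    · exact ⟨1, by simp, by simp, by simpa using h⟩
    · exact ⟨-1, by simp, by simp, by simpa using h⟩
  refine ⟨q, s, hq, hs1, fun n hn => ?_⟩
  have hX : (X ^ k : ℂ[X]) ≠ 0 := pow_ne_zero _ X_ne_zero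
  apply mul_left_cancel₀ hX
  have h3 : (X ^ k : ℂ[X]) * (X ^ (n + l - k) * innerPoly k a) =
      X ^ (n + q) * (X ^ q * innerPoly k a) := by
    rw [← mul_assoc, ← mul_assoc, ← pow_add, ← pow_add, show k + (n + l - k) = n + q + q by omega]
  have h4 : (C s : ℂ[X]) ^ 2 = 1 := by rw [← C_pow, hs2, C_1]
  rw [map_poly_eq hb hn, mul_add, h3, hs3, show 2 * n + l = (n + q) * 2 by omega, pow_mul,
    show (C 2 : ℂ[X]) = 2 from rfl, ← h4]
  ring

/-- If `|f₂| = |E|` identically, the zeros on the circle are double, and counted so. -/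
theorem two_mul_le_numUnimodular {l k : ℕ} {a : ℕ → ℤ} {b : ℕ → ℤ} (hmonic : b l = 1)
    (hb : ∀ j, j ≤ l → b j = b (l - j)) (hG : gapPoly k l a b = 0) {n : ℕ} (hn : k < n) :
    2 * n + l ≤ numUnimodular (poly k l a b n) := by
  obtain ⟨q, s, hq, hs, h⟩ := exists_map_poly_eq_of_gapPoly_eq_zero hmonic hb hG
  have hm : n + q ≠ 0 := by omega
  have hQ : (X ^ (n + q) + C s : ℂ[X]).Monic := monic_X_pow_add_C s hm
  rw [numUnimodular_eq, h n hn, roots_mul ((monic_outerPoly hmonic).mul (hQ.pow 2)).ne_zero,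
    roots_pow, Multiset.countP_add, Multiset.countP_nsmul]
  have h1 : (X ^ (n + q) + C s : ℂ[X]).roots.countP (fun z => ‖z‖ = 1) = n + q := by
    rw [Multiset.countP_eq_card.2, ← (IsAlgClosed.splits _).natDegree_eq_card_roots,
      natDegree_X_pow_add_C]
    intro z hz
    rw [mem_roots hQ.ne_zero, IsRoot, eval_add, eval_pow, eval_X, eval_C] at hz
    have h2 : ‖z‖ ^ (n + q) = 1 := by
      rw [← norm_pow, eq_neg_of_add_eq_zero_left hz, norm_neg, hs]
    exact (pow_eq_one_iff_of_nonneg (norm_nonneg z) hm).1 h2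
  rw [h1]
  omega

theorem tendsto_mul_add_div (l : ℕ) :
    Tendsto (fun n : ℕ => (2 * (n : ℝ) + l) / (2 * n + 2 * l)) atTop (𝓝 1) := by
  have h1 : Tendsto (fun n : ℕ => 2 * (n : ℝ) + 2 * l) atTop atTop :=
    tendsto_atTop_add_const_right _ _ (tendsto_natCast_atTop_atTop.const_mul_atTop two_pos)
  have h2 := (tendsto_const_nhds (x := (l : ℝ))).div_atTop h1
  have h3 := (tendsto_const_nhds (x := (1 : ℝ))).sub h2
  rw [sub_zero] at h3
  refine h3.congr' ?_
  filter_upwards [eventually_gt_atTop 0] with n hn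
  have : (0 : ℝ) < n := by exact_mod_cast hn
  field_simp
  ring

theorem eventually_le_numUnimodular_div {l : ℕ} (k : ℕ) (a : ℕ → ℤ) {b : ℕ → ℤ} (hmonic : b l = 1)
    (hb : ∀ j, j ≤ l → b j = b (l - j)) {ε : ℝ} (hε : 0 < ε) :
    ∀ᶠ n : ℕ in atTop, volume.real (dominatedSet k l a b) / (2 * Real.pi) - ε <
      (numUnimodular (poly k l a b n) : ℝ) / (2 * n + 2 * l) := by
  have hpi := Real.two_pi_pos
  -- It suffices to find, up to an error in the measure, that many zeros relative to `2 n + l`.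
  suffices H : ∀ᶠ n : ℕ in atTop, (volume.real (dominatedSet k l a b) - ε) / (2 * Real.pi) *
      (2 * n + l) ≤ numUnimodular (poly k l a b n) by
    have hlim := (tendsto_mul_add_div l).const_mul
      ((volume.real (dominatedSet k l a b) - ε) / (2 * Real.pi))
    rw [mul_one] at hlim
    have h1 : volume.real (dominatedSet k l a b) / (2 * Real.pi) - ε <
        (volume.real (dominatedSet k l a b) - ε) / (2 * Real.pi) := by
      rw [sub_div, sub_lt_sub_iff_left, div_lt_iff₀ hpi]
      nlinarith [Real.pi_gt_three]
    filter_upwards [H, hlim.eventually_const_lt h1] with n hn hn'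
    refine hn'.trans_le ?_
    rw [← mul_div_assoc]
    gcongr
  by_cases hG : gapPoly k l a b = 0
  · filter_upwards [eventually_gt_atTop k] with n hn
    rw [dominatedSet_eq_Icc hb hG, Real.volume_real_Icc_of_le hpi.le, sub_zero]
    have h1 : (2 * (n : ℝ) + l) ≤ numUnimodular (poly k l a b n) := by
      exact_mod_cast two_mul_le_numUnimodular hmonic hb hG hn
    have h2 : (2 * Real.pi - ε) / (2 * Real.pi) ≤ 1 := by
      rw [div_le_one hpi]; linarith
    refine le_trans ?_ h1
    exact mul_le_of_le_one_left (by positivity) h2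
  · have hM : Tendsto (fun n : ℕ => 2 * n + l) atTop atTop :=
      tendsto_atTop_mono (fun n => by rw [id]; omega) tendsto_id
    filter_upwards [hM.eventually (eventually_volume_le_card_mul (continuous_gap_exp k l a b) hε),
      eventually_gt_atTop k] with n hn hk
    obtain ⟨J, hJ, hJpos, hJvol⟩ := hn
    have h1 : (J.card : ℝ) ≤ numUnimodular (poly k l a b n) := by
      exact_mod_cast card_le_numUnimodular a hmonic hb hk hJ hJpos
    have h2 := volume_dominatedSet_le hb hG
    have hpos : (0 : ℝ) < 2 * n + l := by exact_mod_cast (by omega : 0 < 2 * n + l)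
    refine le_trans ?_ h1
    push_cast at hJvol
    rw [← mul_div_assoc, le_div_iff₀ hpos] at hJvol
    rw [div_mul_eq_mul_div, div_le_iff₀ hpi]
    refine le_trans ?_ hJvol
    gcongr

theorem eventually_numUnimodular_div_le {l : ℕ} (k : ℕ) (a : ℕ → ℤ) {b : ℕ → ℤ} (hmonic : b l = 1)
    (hb : ∀ j, j ≤ l → b j = b (l - j)) {ε : ℝ} (hε : 0 < ε) :
    ∀ᶠ n : ℕ in atTop, (numUnimodular (poly k l a b n) : ℝ) / (2 * n + 2 * l) ≤
      volume.real (dominatedSet k l a b) / (2 * Real.pi) + ε := by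
  have hdeg : ∀ᶠ n : ℕ in atTop,
      ((poly k l a b n).map (algebraMap ℤ ℂ)).natDegree = 2 * n + 2 * l := by
    filter_upwards [eventually_gt_atTop k] with n hn
    exact natDegree_map_poly a hmonic hb hn
  have h := Polynomial.eventually_countP_norm_eq_one_le
    (p := fun n => (poly k l a b n).map (algebraMap ℤ ℂ))
    (A := 2 * (outerPoly l b).coeffNorm + (innerPoly k a).coeffNorm) ?_ ?_
    (continuous_gap k l a b) ?_ hε
  · filter_upwards [h, hdeg] with n hn hd
    rw [hd] at hn
    push_cast at hn
    exact hn
  · filter_upwards [eventually_gt_atTop k] with n hn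
    exact ⟨monic_map_poly a hmonic hb hn, coeffNorm_map_poly_le a hb hn,
      by rw [coeff_zero_map_poly a hmonic hb hn, norm_one]⟩
  · refine Tendsto.congr' (hdeg.mono fun n hn => hn.symm) ?_
    exact tendsto_atTop_mono (fun n => by rw [id]; omega) tendsto_id
  · filter_upwards [eventually_gt_atTop k] with n hn z hz hz1
    rw [mem_roots (monic_map_poly a hmonic hb hn).ne_zero, IsRoot, map_poly_eq hb hn] at hz
    simp only [eval_add, eval_mul, eval_pow, eval_X, eval_one] at hz
    -- At a zero, `x ^ (n + l - k) * innerPoly` cancels `(x ^ (2 n + l) + 1) * outerPoly`.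
    have h1 : ‖(innerPoly k a).eval z‖ ≤ 2 * ‖(outerPoly l b).eval z‖ := by
      have h2 := congrArg norm (eq_neg_of_add_eq_zero_right hz)
      rw [norm_neg, norm_mul, norm_mul, norm_pow, hz1, one_pow, one_mul] at h2
      rw [h2]
      gcongr
      refine (norm_add_le _ _).trans ?_
      rw [norm_pow, hz1, one_pow, norm_one]
      norm_num
    rw [gap]
    nlinarith [norm_nonneg ((innerPoly k a).eval z)]

end LimitRatio

/-! ### The limit of the ratio -/

theorem mainTheorem1 (k l : ℕ) (hk : 0 < k) (a b : ℕ → ℤ)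
    (hmonic : b l = 1) (hb : ∀ j, j ≤ l → b j = b (l - j)) :
    (∀ n : ℕ, k < n →
      (LimitRatio.poly k l a b n).natDegree = 2 * n + 2 * l ∧
      LimitRatio.ratio (LimitRatio.poly k l a b n) =
        1 - (LimitRatio.numUnimodular (LimitRatio.poly k l a b n) : ℝ)
              / (2 * (n : ℝ) + 2 * (l : ℝ))) ∧
    ∃ (r : ℕ) (α β : Fin r → ℝ),
      (∀ i, α i ≤ β i) ∧
      (∀ i j, i < j → β i < α j) ∧
      {t : ℝ | t ∈ Set.Icc 0 (2 * Real.pi) ∧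
          |LimitRatio.f₂ k a t| ≤ |LimitRatio.envelope l b t|} =
        ⋃ i, Set.Icc (α i) (β i) ∧
      Tendsto (fun n : ℕ => LimitRatio.ratio (LimitRatio.poly k l a b n)) atTop
        (𝓝 (1 - ∑ i, (β i - α i) / (2 * Real.pi))) := by
  have hdeg : ∀ n : ℕ, k < n → (LimitRatio.poly k l a b n).natDegree = 2 * n + 2 * l := by
    intro n hn
    rw [← LimitRatio.natDegree_map_poly a hmonic hb hn]
    exact (natDegree_map_eq_of_injective (algebraMap ℤ ℂ).injective_int _).symm
  have hratio : ∀ n : ℕ, k < n → LimitRatio.ratio (LimitRatio.poly k l a b n) =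
      1 - (LimitRatio.numUnimodular (LimitRatio.poly k l a b n) : ℝ)
        / (2 * (n : ℝ) + 2 * (l : ℝ)) := by
    intro n hn
    rw [LimitRatio.ratio_eq_one_sub (by rw [hdeg n hn]; omega), hdeg n hn]
    push_cast
    rfl
  refine ⟨fun n hn => ⟨hdeg n hn, hratio n hn⟩, ?_⟩
  obtain ⟨r, α, β, h1, h2, h3⟩ :=
    (LimitRatio.isCompact_dominatedSet k l a b).exists_eq_iUnion_Icc
      (LimitRatio.finite_left_endpoints_dominatedSet k a hb)
  refine ⟨r, α, β, h1, h2, ?_, ?_⟩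
  · rw [← h3]
    ext t
    exact and_congr_right fun _ => LimitRatio.abs_f₂_le_iff k a hb t
  · rw [← Finset.sum_div, ← volume_real_iUnion_Icc h1 h2, ← h3]
    refine Tendsto.congr' ?_ (Tendsto.const_sub 1 (f := fun n : ℕ =>
      (LimitRatio.numUnimodular (LimitRatio.poly k l a b n) : ℝ) / (2 * n + 2 * l)) ?_)
    · filter_upwards [eventually_gt_atTop k] with n hn
      exact (hratio n hn).symm
    · rw [Metric.tendsto_nhds]
      intro ε hε
      filter_upwards [LimitRatio.eventually_le_numUnimodular_div k a hmonic hb hε,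
        LimitRatio.eventually_numUnimodular_div_le k a hmonic hb (half_pos hε)] with n hl hu
      rw [Real.dist_eq, abs_lt]
      constructor <;> linarith
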